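/- **Setting.** Let $\Sigma$ be an alphabet with a converse operation $a\mapsto\bar a$, $\bar{\bar a}=a$, partitioned into $\Sigma^+,\Sigma^-$ with $a\in\Sigma^+$ iff $\bar a\in\Sigma^-$; put $\overline{a_1\cdots a_n}=\bar a_n\cdots\bar a_1$. A semi-Thue system $S$ is a set of rules $u\to v$ over $\Sigma^*$; it is *closed* if $u\to v\in S$ implies $\bar u\to\bar v\in S$, and *context-free* if every left-hand side is a single letter. $L_a(S)$ is the set of words reachable from $a$ by rewriting with $S$. Formulae are in negation normal form, $A::=p\mid\neg p\mid A\lor A\mid A\land A\mid[a]A\mid\langle a\rangle A$ (with denumerably many atoms $p$), and are interpreted in Kripke models with relations $R_a$, $R_{\bar a}=R_a^{-1}$. A model satisfies $S$ if $R_v\subseteq R_u$ for all $u\to v\in S$, where $R_u$ is the composition of the relations of the letters of $u$. $F$ is *$S$-valid* if it is true at every world of every model satisfying $S$ (the grammar logic of $S$). A nested sequent $\Gamma$ is a finite tree with a multiset $\Gamma|i$ of formulae at each node $i$ and a letter on each edge. Write $i\triangleright^a j$ if $j$ is a child of $i$ along an edge labelled $a$, and $\Gamma(i\ll\Delta)$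 for the result of adding $\Delta$ to the node $i$; $\{F\}$ is the one-node sequent with formula $F$ and $[A]_a$ is an edge labelled $a$ to a new node with formula $A$. $\mathcal R(\Gamma,i,j)$ is the automaton whose states are the nodes of $\Gamma$, with initial state $i$, final state $j$ and transitions $x\xrightarrow{a}y$, $y\xrightarrow{\bar a}x$ for each $x\triangleright^a y$. **Calculus $\mathrm{DKm}(S)$.** $\Gamma$ is derivable outright if some $\Gamma|i$ contains $p$ and $\neg p$. Moreover, $\Gamma$ may be inferred: if $A\land B\in\Gamma|i$, from both $\Gamma(i\ll A)$ and $\Gamma(i\ll B)$; if $A\lor B\in\Gamma|i$, from $\Gamma(i\ll A,B)$; if $[a]A\in\Gamma|i$, from $\Gamma(i\ll[A]_a)$; if $\langle a\rangle A\in\Gamma|i$ and $i\triangleright^a j$, from $\Gamma(j\ll A)$; if $\langle\bar a\rangle A\in\Gamma|j$ and $i\triangleright^a j$, from $\Gamma(i\ll A)$; if $\langle a\rangle A\in\Gamma|i$ and $\mathcal R(\Gamma,i,j)\cap L_a(S)\neq\emptyset$, from $\Gamma(j\ll A)$. **Stability.** A node $i$ is *saturated* if $\Gamma|i$ contains no $A$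 together with the negation normal form of $\neg A$, contains both disjuncts of each of its disjunctions, and contains at least one conjunct of each of its conjunctions. It is *realised* if for each $[a]A\in\Gamma|i$ there is $j$ with $i\triangleright^a j$ and $A\in\Gamma|j$. For an automaton $\mathcal P$ on nodes of $\Gamma$ with initial state $i$ and final state $j$, $\Gamma$ is *$(S,\mathcal P)$-propagated* if $\langle a\rangle A\in\Gamma|i$ and $\mathcal P\cap L_a(S)\ne\emptyset$ imply $A\in\Gamma|j$; $\Gamma$ is *$S$-propagated* if it is $(S,\mathcal R(\Gamma,i,j))$-propagated for all nodes $i,j$. $\Gamma$ is *$S$-stable* if all nodes are saturated, $\Gamma$ is $S$-propagated, all internal nodes are realised, and one can assign to each unrealised leaf $x$ a proper ancestor $\lambda(x)$ with $\Gamma|x=\Gamma|\lambda(x)$ such that, for all nodes $y,z$, $\Gamma$ is $(S,\mathcal P)$-propagated for the automaton $\mathcal P$ obtained from $\mathcal R(\Gamma,y,z)$ by renaming each unrealised leaf $x$ to $\lambda(x)$. **Procedure.** The non-deterministic procedure $\mathit{Prove}_2(S,\Gamma,k)$ performs the first step that applies (with any choice of the formula and nodes involved): (1) if some $\Gamma|i$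 contains $p,\neg p$, return $\top$; (2) if $\Gamma$ is $S$-stable, return $\bot$; (3) if $A\lor B\in\Gamma|i$ but $A\notin\Gamma|i$ or $B\notin\Gamma|i$, continue with $\Gamma(i\ll A,B)$; or, if $A\land B\in\Gamma|i$ but $A,B\notin\Gamma|i$, call the procedure on $\Gamma(i\ll A)$ and on $\Gamma(i\ll B)$ and return $\bot$ if one result is $\bot$, otherwise $\star$ if one result is $\star$, otherwise $\top$; (4) if $\langle a\rangle A\in\Gamma|i$, $\mathcal R(\Gamma,i,j)\cap L_a(S)\neq\emptyset$ and $A\notin\Gamma|j$, continue with $\Gamma(j\ll A)$; (5) if $i$ is an internal node, $[a]A\in\Gamma|i$ and $A\notin\Gamma|j$ for all $j$ with $i\triangleright^a j$, continue with $\Gamma(i\ll[A]_a)$; (6) if $i$ is a leaf at distance at most $k$ from the root and $[a]A\in\Gamma|i$, continue with $\Gamma(i\ll[A]_a)$; (7) return $\star$. $\mathit{Prove}(S,\Gamma)$ runs $\mathit{Prove}_2(S,\Gamma,k)$ for $k=0,1,2,\dots$ until the result is $\top$ or $\bot$, and returns that result. **Theorem.** Let $S$ be a context-free closed semi-Thue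 system over $\Sigma$. 1. For every formula $F$ the following are equivalent: some run of $\mathit{Prove}(S,\{F\})$ returns $\top$; every run of $\mathit{Prove}(S,\{F\})$ terminates and returns $\top$; $\{F\}$ is derivable in $\mathrm{DKm}(S)$. 2. $\mathit{Prove}$ is a semi-decision procedure for the grammar logic of $S$: for every formula $F$, $\mathit{Prove}(S,\{F\})$ returns $\top$ iff $F$ is $S$-valid; every run of every call $\mathit{Prove}_2(S,\{F\},k)$ terminates; and if $\Sigma$ and $S$ are finite, then the set of (codes of) formulae $F$ such that $\mathit{Prove}(S,\{F\})$ returns $\top$ is recursively enumerable. 3. For every $S$-stable nested sequent $\Gamma$ there is a model satisfying $S$ such that for every node $x$ of $\Gamma$ there is a world at which every $A\in\Gamma|x$ is false. -/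

import Mathlib

universe u w

namespace GrammarLogic

/-! ### Alphabets with converse, formulae, semi-Thue systems -/

/-- An alphabet `L` with a converse operation `conv`, partitioned into a positive and a negative
part that are exchanged by `conv`. -/
class ConverseAlphabet (L : Type u) where
  conv : L → L
  conv_conv : ∀ a, conv (conv a) = a
  pos : Set L
  mem_pos_iff : ∀ a, a ∈ pos ↔ conv a ∉ pos

open ConverseAlphabet (conv)

/-- The converse of a word: reverse it and take the converse of each letter. -/
def convWord {L : Type u} [ConverseAlphabet L] (v : List L) : List L := (v.map conv).reverse

/-- Multi-modal formulae in negation normal form. `natom p` is the negated atom. -/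
inductive Fml (L : Type u) : Type u
  | atom (p : ℕ)
  | natom (p : ℕ)
  | or (A B : Fml L)
  | and (A B : Fml L)
  | box (a : L) (A : Fml L)
  | dia (a : L) (A : Fml L)

namespace Fml

/-- The negation normal form of the negation of a formula. -/
def neg {L : Type u} : Fml L → Fml L
  | atom p => natom p
  | natom p => atom p
  | or A B => and A.neg B.neg
  | and A B => or A.neg B.neg
  | box a A => dia a A.neg
  | dia a A => box a A.neg

/-- Formulae in Polish notation, as lists of numbers, given a numbering `c` of the alphabet. -/
def code {L : Type u} (c : L → ℕ) : Fml L → List ℕ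
  | atom p => [0, p]
  | natom p => [1, p]
  | or A B => 2 :: (A.code c ++ B.code c)
  | and A B => 3 :: (A.code c ++ B.code c)
  | box a A => 4 :: c a :: A.code c
  | dia a A => 5 :: c a :: A.code c

end Fml

/-- A semi-Thue system: a set of production rules `u → v`, written as pairs `(u, v)`. -/
abbrev SemiThue (L : Type u) := Set (List L × List L)

namespace SemiThue

/-- `S` is closed if `u → v ∈ S` implies that the rule between the converses is in `S`. -/
def Closed {L : Type u} [ConverseAlphabet L] (S : SemiThue L) : Prop :=
  ∀ l r, (l, r) ∈ S → (convWord l, convWord r) ∈ S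

/-- `S` is context-free if every left-hand side is a single letter. -/
def ContextFree {L : Type u} (S : SemiThue L) : Prop :=
  ∀ l r, (l, r) ∈ S → ∃ a, l = [a]

/-- One rewriting step. -/
def Rewrites {L : Type u} (S : SemiThue L) (v v' : List L) : Prop :=
  ∃ x y l r, (l, r) ∈ S ∧ v = x ++ l ++ y ∧ v' = x ++ r ++ y

/-- The language of all words that can be reached from the letter `a` by rewriting. -/
def lang {L : Type u} (S : SemiThue L) (a : L) : Language L :=
  {v | Relation.ReflTransGen S.Rewrites [a] v}

end SemiThue

/-! ### Kripke semantics -/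

/-- A model over the set `W` of worlds. -/
structure Model (L : Type u) [ConverseAlphabet L] (W : Type w) where
  rel : L → W → W → Prop
  rel_conv : ∀ a x y, rel a x y ↔ rel (conv a) y x
  val : ℕ → Set W

namespace Model

variable {L : Type u} [ConverseAlphabet L] {W : Type w}

/-- The accessibility relation of a word. -/
def wordRel (M : Model L W) : List L → W → W → Prop
  | [], x, y => x = y
  | a :: v, x, y => ∃ z, M.rel a x z ∧ M.wordRel v z y

/-- The frame of `M` satisfies `S`: for every rule `l → r`, `R_r ⊆ R_l`. -/
def Satisfies (M : Model L W) (S : SemiThue L) : Prop :=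
  ∀ l r, (l, r) ∈ S → ∀ x y, M.wordRel r x y → M.wordRel l x y

/-- Truth of a formula at a world. -/
def Sat (M : Model L W) : W → Fml L → Prop
  | x, .atom p => x ∈ M.val p
  | x, .natom p => x ∉ M.val p
  | x, .or A B => M.Sat x A ∨ M.Sat x B
  | x, .and A B => M.Sat x A ∧ M.Sat x B
  | x, .box a A => ∀ y, M.rel a x y → M.Sat y A
  | x, .dia a A => ∃ y, M.rel a x y ∧ M.Sat y A

end Model

/-- `F` is `S`-valid: true at every world of every model whose frame satisfies `S`
(worlds ranging over types in universe `w`). -/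
def SValid {L : Type u} [ConverseAlphabet L] (S : SemiThue L) (F : Fml L) : Prop :=
  ∀ (W : Type w) (M : Model L W), M.Satisfies S → ∀ x, M.Sat x F

/-! ### Nested sequents as trees -/

/-- A nested sequent `A₁, …, Aₘ, [Δ₁]_{a₁}, …, [Δₙ]_{aₙ}`: a finite tree with a multiset of
formulae at each node and a letter on each edge. -/
inductive NSeq (L : Type u) : Type u
  | mk (fmls : Multiset (Fml L)) (children : List (L × NSeq L))

namespace NSeq

variable {L : Type u}

/-- The formulae at the root. -/
def fmls : NSeq L → Multiset (Fml L)
  | mk fs _ => fs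

/-- The bracketed sequents below the root. -/
def children : NSeq L → List (L × NSeq L)
  | mk _ cs => cs

/-- The sequent consisting of formulae only. -/
def ofFmls (fs : Multiset (Fml L)) : NSeq L := mk fs []

/-- The sequent `[A]_a`. -/
def bracket (a : L) (A : Fml L) : NSeq L := mk 0 [(a, ofFmls {A})]

/-- Nodes are identified by their addresses: `[]` is the root, and `i ++ [n]` is child number `n`
of the node `i`. `subAt Γ i` is the subtree at `i`, if `i` is a node of `Γ`. -/
def subAt : NSeq L → List ℕ → Option (NSeq L)
  | Γ, [] => some Γ
  | Γ, n :: i => (Γ.children[n]?).bind fun c => c.2.subAt i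

def IsNode (Γ : NSeq L) (i : List ℕ) : Prop := ∃ Δ, Γ.subAt i = some Δ

/-- `Γ|i`, the multiset of formulae at the node `i` (empty if `i` is not a node). -/
def at' (Γ : NSeq L) (i : List ℕ) : Multiset (Fml L) :=
  match Γ.subAt i with
  | some Δ => Δ.fmls
  | none => 0

/-- `j` is a child of `i` and the edge from `i` to `j` is labelled with `a`. -/
def Edge (Γ : NSeq L) (i : List ℕ) (a : L) (j : List ℕ) : Prop :=
  ∃ Δ n c, Γ.subAt i = some Δ ∧ Δ.children[n]? = some (a, c) ∧ j = i ++ [n]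

def Leaf (Γ : NSeq L) (i : List ℕ) : Prop := Γ.IsNode i ∧ ∀ a j, ¬ Γ.Edge i a j

def Internal (Γ : NSeq L) (i : List ℕ) : Prop := Γ.IsNode i ∧ ∃ a j, Γ.Edge i a j

/-- `j` is a proper ancestor of `i`. -/
def Ancestor (j i : List ℕ) : Prop := j <+: i ∧ j ≠ i

/-- The length of the branch from the root to the node `i`. -/
def height (i : List ℕ) : ℕ := i.length

/-- `Γ(i ≪ Δ)`: add `Δ` to the node `i` of `Γ` (no change if `i` is not a node). -/
def add : NSeq L → List ℕ → NSeq L → NSeq L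
  | Γ, [], Δ => mk (Γ.fmls + Δ.fmls) (Γ.children ++ Δ.children)
  | Γ, n :: i, Δ => mk Γ.fmls (Γ.children.modify n fun c => (c.1, c.2.add i Δ))

/-! ### Propagation automata and propagation -/

variable [ConverseAlphabet L]

/-- The propagation automaton `R(Γ, i, j)`: each edge `x -a→ y` of `Γ` gives the transitions
`x -a→ y` and `y -ā→ x`. -/
def automaton (Γ : NSeq L) (i j : List ℕ) : NFA L (List ℕ) where
  step x a := {y | Γ.Edge x a y ∨ Γ.Edge y (conv a) x}
  start := {i}
  accept := {j}

/-- The automaton obtained by applying the map `θ` to all states. -/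
def mapStates {Q : Type} (P : NFA L Q) (θ : Q → Q) : NFA L Q where
  step x a := {y | ∃ x' y', θ x' = x ∧ θ y' = y ∧ y' ∈ P.step x' a}
  start := θ '' P.start
  accept := θ '' P.accept

/-- `Γ` is `(S, P)`-propagated, for an automaton `P` whose states are nodes of `Γ`. -/
def PropagatedAlong (S : SemiThue L) (Γ : NSeq L) (P : NFA L (List ℕ)) : Prop :=
  ∀ i ∈ P.start, ∀ j ∈ P.accept, ∀ a A, Fml.dia a A ∈ Γ.at' i →
    (∃ v, v ∈ P.accepts ∧ v ∈ S.lang a) → A ∈ Γ.at' j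

/-- `Γ` is `S`-propagated. -/
def Propagated (S : SemiThue L) (Γ : NSeq L) : Prop :=
  ∀ i j, Γ.IsNode i → Γ.IsNode j → Γ.PropagatedAlong S (Γ.automaton i j)

/-! ### The deep inference calculus -/

/-- Derivability of nested sequents in `DKm(S)`. -/
inductive DKm (S : SemiThue L) : NSeq L → Prop
  | id_d (Γ : NSeq L) (i : List ℕ) (p : ℕ)
      (h : Fml.atom p ∈ Γ.at' i) (h' : Fml.natom p ∈ Γ.at' i) : DKm S Γ
  | and_d (Γ : NSeq L) (i : List ℕ) (A B : Fml L) (h : Fml.and A B ∈ Γ.at' i)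
      (prem₁ : DKm S (Γ.add i (ofFmls {A}))) (prem₂ : DKm S (Γ.add i (ofFmls {B}))) : DKm S Γ
  | or_d (Γ : NSeq L) (i : List ℕ) (A B : Fml L) (h : Fml.or A B ∈ Γ.at' i)
      (prem : DKm S (Γ.add i (ofFmls {A, B}))) : DKm S Γ
  | box_d (Γ : NSeq L) (i : List ℕ) (a : L) (A : Fml L) (h : Fml.box a A ∈ Γ.at' i)
      (prem : DKm S (Γ.add i (bracket a A))) : DKm S Γ
  | dia_up (Γ : NSeq L) (i j : List ℕ) (a : L) (A : Fml L) (e : Γ.Edge i a j)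
      (h : Fml.dia a A ∈ Γ.at' i) (prem : DKm S (Γ.add j (ofFmls {A}))) : DKm S Γ
  | dia_down (Γ : NSeq L) (i j : List ℕ) (a : L) (A : Fml L) (e : Γ.Edge i a j)
      (h : Fml.dia (conv a) A ∈ Γ.at' j) (prem : DKm S (Γ.add i (ofFmls {A}))) : DKm S Γ
  | prop_S (Γ : NSeq L) (i j : List ℕ) (a : L) (A : Fml L) (hi : Γ.IsNode i) (hj : Γ.IsNode j)
      (h : Fml.dia a A ∈ Γ.at' i)
      (hL : ∃ v, v ∈ (Γ.automaton i j).accepts ∧ v ∈ S.lang a)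
      (prem : DKm S (Γ.add j (ofFmls {A}))) : DKm S Γ

/-! ### Saturation, realisation and stability -/

def Saturated (Γ : NSeq L) (i : List ℕ) : Prop :=
  (∀ A, A ∈ Γ.at' i → A.neg ∉ Γ.at' i) ∧
  (∀ A B, Fml.or A B ∈ Γ.at' i → A ∈ Γ.at' i ∧ B ∈ Γ.at' i) ∧
  (∀ A B, Fml.and A B ∈ Γ.at' i → A ∈ Γ.at' i ∨ B ∈ Γ.at' i)

def Realised (Γ : NSeq L) (i : List ℕ) : Prop :=
  ∀ a A, Fml.box a A ∈ Γ.at' i → ∃ j, Γ.Edge i a j ∧ A ∈ Γ.at' j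

/-- `x` is an unrealised leaf node. -/
def UnrealisedLeaf (Γ : NSeq L) (x : List ℕ) : Prop := Γ.Leaf x ∧ ¬ Γ.Realised x

/-- `Γ` is `S`-stable. The map `θ` is the simultaneous substitution that sends each unrealised
leaf node `x` to the chosen ancestor `θ x` of `x` and is the identity elsewhere. -/
def Stable (S : SemiThue L) (Γ : NSeq L) : Prop :=
  (∀ i, Γ.IsNode i → Γ.Saturated i) ∧
  Γ.Propagated S ∧
  (∀ i, Γ.Internal i → Γ.Realised i) ∧
  ∃ θ : List ℕ → List ℕ,
    (∀ x, Γ.UnrealisedLeaf x → Ancestor (θ x) x ∧ Γ.at' x = Γ.at' (θ x)) ∧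
    (∀ x, ¬ Γ.UnrealisedLeaf x → θ x = x) ∧
    ∀ y z, Γ.IsNode y → Γ.IsNode z →
      Γ.PropagatedAlong S (mapStates (Γ.automaton y z) θ)

/-! ### The proof search procedure -/

/-- `Γ = Γ'[p, ¬p]`. -/
def Clash (Γ : NSeq L) : Prop := ∃ i p, Fml.atom p ∈ Γ.at' i ∧ Fml.natom p ∈ Γ.at' i

/-- A disjunction at `i` that still has to be treated. -/
def OrTask (Γ : NSeq L) (i : List ℕ) (A B : Fml L) : Prop :=
  Fml.or A B ∈ Γ.at' i ∧ (A ∉ Γ.at' i ∨ B ∉ Γ.at' i)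

/-- A conjunction at `i` that still has to be treated. -/
def AndTask (Γ : NSeq L) (i : List ℕ) (A B : Fml L) : Prop :=
  Fml.and A B ∈ Γ.at' i ∧ A ∉ Γ.at' i ∧ B ∉ Γ.at' i

/-- `◇_a A` at `i` still has to be propagated to `j`. -/
def DiaTask (S : SemiThue L) (Γ : NSeq L) (i j : List ℕ) (a : L) (A : Fml L) : Prop :=
  Γ.IsNode i ∧ Γ.IsNode j ∧ Fml.dia a A ∈ Γ.at' i ∧
    (∃ v, v ∈ (Γ.automaton i j).accepts ∧ v ∈ S.lang a) ∧ A ∉ Γ.at' j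

/-- `□_a A` at `i` still has to be realised. -/
def BoxTask (Γ : NSeq L) (i : List ℕ) (a : L) (A : Fml L) : Prop :=
  Fml.box a A ∈ Γ.at' i ∧ ∀ j, Γ.Edge i a j → A ∉ Γ.at' j

end NSeq

open NSeq

/-- The three possible results `⊤`, `⊥`, `⋆` of the bounded procedure. -/
inductive Outcome
  | top
  | bot
  | star

/-- The result for a conjunction: `⊥` if one of the two results is `⊥`, otherwise `⋆` if one of
them is `⋆`, otherwise `⊤`. -/
def Outcome.combine : Outcome → Outcome → Outcome
  | .bot, _ => .bot
  | _, .bot => .bot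
  | .star, _ => .star
  | _, .star => .star
  | .top, .top => .top

/-- What one pass through the body of the bounded procedure does: return a result, return the
result of a recursive call, or combine the results of two recursive calls. -/
inductive Action (L : Type u) : Type u
  | ret (r : Outcome)
  | call (Γ : NSeq L)
  | fork (Γ₁ Γ₂ : NSeq L)

section Procedure

variable {L : Type u} [ConverseAlphabet L]

/-- `Γ` has no clash and is not stable. -/
def NoClashNotStable (S : SemiThue L) (Γ : NSeq L) : Prop := ¬ Γ.Clash ∧ ¬ Γ.Stable S

/-- Moreover no disjunction or conjunction has to be treated. -/
def NoLocalTask (S : SemiThue L) (Γ : NSeq L) : Prop :=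
  NoClashNotStable S Γ ∧ (∀ i A B, ¬ Γ.OrTask i A B) ∧ ∀ i A B, ¬ Γ.AndTask i A B

/-- Moreover nothing has to be propagated. -/
def NoDiaTask (S : SemiThue L) (Γ : NSeq L) : Prop :=
  NoLocalTask S Γ ∧ ∀ i j a A, ¬ Γ.DiaTask S i j a A

/-- Moreover every internal node is realised. -/
def NoInternalTask (S : SemiThue L) (Γ : NSeq L) : Prop :=
  NoDiaTask S Γ ∧ ∀ i a A, Γ.Internal i → ¬ Γ.BoxTask i a A

/-- Moreover every leaf node of height at most `k` is realised. -/
def NoLeafTask (S : SemiThue L) (k : ℕ) (Γ : NSeq L) : Prop :=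
  NoInternalTask S Γ ∧ ∀ i a A, Γ.Leaf i → height i ≤ k → ¬ Γ.BoxTask i a A

/-- `Step S k Γ α`: the body of `Prove₂(S, Γ, k)` may perform the action `α`. The steps are tried
in the order of the constructors, disjunctions and conjunctions with equal priority; which formula and
which nodes are treated is chosen non-deterministically. -/
inductive Step (S : SemiThue L) (k : ℕ) (Γ : NSeq L) : Action L → Prop
  | clash (h : Γ.Clash) : Step S k Γ (.ret .top)
  | stable (h : ¬ Γ.Clash) (h' : Γ.Stable S) : Step S k Γ (.ret .bot)
  | or (h : NoClashNotStable S Γ) (i : List ℕ) (A B : Fml L) (t : Γ.OrTask i A B) :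
      Step S k Γ (.call (Γ.add i (ofFmls {A, B})))
  | and (h : NoClashNotStable S Γ) (i : List ℕ) (A B : Fml L) (t : Γ.AndTask i A B) :
      Step S k Γ (.fork (Γ.add i (ofFmls {A})) (Γ.add i (ofFmls {B})))
  | dia (h : NoLocalTask S Γ) (i j : List ℕ) (a : L) (A : Fml L) (t : Γ.DiaTask S i j a A) :
      Step S k Γ (.call (Γ.add j (ofFmls {A})))
  | boxInternal (h : NoDiaTask S Γ) (i : List ℕ) (a : L) (A : Fml L) (hi : Γ.Internal i)
      (t : Γ.BoxTask i a A) : Step S k Γ (.call (Γ.add i (bracket a A)))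
  | boxLeaf (h : NoInternalTask S Γ) (i : List ℕ) (a : L) (A : Fml L) (hi : Γ.Leaf i)
      (hk : height i ≤ k) (t : Γ.BoxTask i a A) : Step S k Γ (.call (Γ.add i (bracket a A)))
  | star (h : NoLeafTask S k Γ) : Step S k Γ (.ret .star)

/-- `Prove₂ S k Γ r`: some run of the bounded procedure `Prove₂(S, Γ, k)` returns `r`. -/
inductive Prove₂ (S : SemiThue L) (k : ℕ) : NSeq L → Outcome → Prop
  | ret {Γ r} (h : Step S k Γ (.ret r)) : Prove₂ S k Γ r
  | call {Γ Γ' r} (h : Step S k Γ (.call Γ')) (h' : Prove₂ S k Γ' r) : Prove₂ S k Γ r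
  | fork {Γ Γ₁ Γ₂ r₁ r₂} (h : Step S k Γ (.fork Γ₁ Γ₂)) (h₁ : Prove₂ S k Γ₁ r₁)
      (h₂ : Prove₂ S k Γ₂ r₂) : Prove₂ S k Γ (r₁.combine r₂)

/-- `Prove₂(S, Γ, k)` may call itself recursively on `Γ'`. -/
def Calls (S : SemiThue L) (k : ℕ) (Γ Γ' : NSeq L) : Prop :=
  Step S k Γ (.call Γ') ∨ ∃ Δ, Step S k Γ (.fork Γ' Δ) ∨ Step S k Γ (.fork Δ Γ')

/-- Every run of `Prove₂(S, Γ, k)` terminates: there is no infinite chain of recursive calls. -/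
def Prove₂Terminates (S : SemiThue L) (k : ℕ) (Γ : NSeq L) : Prop :=
  Acc (fun Δ' Δ => Calls S k Δ Δ') Γ

/-- Some run of the loop of `Prove(S, Γ)`, entered with the value `k`, returns `r`. -/
inductive ProveFrom (S : SemiThue L) (Γ : NSeq L) (r : Outcome) : ℕ → Prop
  | done {k} (h : Prove₂ S k Γ r) (hr : r ≠ .star) : ProveFrom S Γ r k
  | next {k} (h : Prove₂ S k Γ .star) (h' : ProveFrom S Γ r (k + 1)) : ProveFrom S Γ r k

/-- Some run of `Prove(S, Γ)` returns `r`. -/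
def ProveReturns (S : SemiThue L) (Γ : NSeq L) (r : Outcome) : Prop := ProveFrom S Γ r 0

/-- Every run of the loop of `Prove(S, Γ)`, entered with the value `k`, terminates and
returns `r`. -/
inductive ProveAlwaysFrom (S : SemiThue L) (Γ : NSeq L) (r : Outcome) : ℕ → Prop
  | intro {k} (ht : Prove₂Terminates S k Γ)
      (hr : ∀ r', Prove₂ S k Γ r' → r' ≠ .star → r' = r)
      (hs : Prove₂ S k Γ .star → ProveAlwaysFrom S Γ r (k + 1)) : ProveAlwaysFrom S Γ r k

/-- Every run of `Prove(S, Γ)` terminates and returns `r`. -/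
def ProveAlwaysReturns (S : SemiThue L) (Γ : NSeq L) (r : Outcome) : Prop :=
  ProveAlwaysFrom S Γ r 0

end Procedure

end GrammarLogic

/-! All the equivalences come from one cycle. A run that returns `⊤` is, read backwards, a
derivation (`dkm_of_prove₂_top`). Derivable formulae are valid (`sValid_of_dkm`). For a valid
formula every run returns `⊤` (`proveAlwaysReturns_of_sValid`).

The last implication needs three facts. Each bounded call terminates, because calls strictly enlarge
a sequent inside a finite space (`prove₂Terminates`). No bounded call returns `⊥`, because a stable
sequent has a countermodel. Some bound `n` excludes `⋆`: if `⋆` were possible for every bound, the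
final sequents of the runs, one for each `k`, would have a limit along a nonprincipal ultrafilter,
and this limit is a countermodel (`not_sValid_of_forall_noLeafTask`). The sequents for different `k`
need not be related, so the arbitrary choices of the procedure do no harm.

Both countermodels come from `Hintikka.exists_model`. Start with labelled steps that are symmetric
under converse, and let `R_a` consist of the walks whose word lies in `L_a(S)`. Closedness gives the
converse condition, and context-freeness makes the model satisfy `S`. A false `◇_a A` forces `A` to
be false at the ends of exactly those walks along which propagation is required.

Recursive enumerability is obtained without arithmetising the procedure. By the cycle it suffices to
enumerate the valid formulae. Failure of a formula in a model is described by disjunctive ground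
rules whose terms are Skolem names of worlds. The formula is valid iff the rules refute the
assumption that it fails, and a fair search finds every refutation (`closedBy_iff_exists_stages`).
-/

namespace GrammarLogic

open ConverseAlphabet (conv)
open NSeq

/-! ### Nodes, edges and labels of a sequent -/

namespace NSeq

variable {L : Type u}

/-- The formulae at a node together with the letters on the edges to its children. -/
def data (Γ : NSeq L) (x : List ℕ) : Option (Multiset (Fml L) × List L) :=
  (Γ.subAt x).map fun Δ => (Δ.fmls, Δ.children.map Prod.fst)

theorem subAt_nil (Γ : NSeq L) : Γ.subAt [] = some Γ := by rw [subAt]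

theorem subAt_cons (Γ : NSeq L) (n : ℕ) (i : List ℕ) :
    Γ.subAt (n :: i) = (Γ.children[n]?).bind fun c => c.2.subAt i := by rw [subAt]

theorem add_nil (Γ Δ : NSeq L) :
    Γ.add [] Δ = mk (Γ.fmls + Δ.fmls) (Γ.children ++ Δ.children) := by rw [add]

theorem add_cons (Γ Δ : NSeq L) (n : ℕ) (i : List ℕ) :
    Γ.add (n :: i) Δ = mk Γ.fmls (Γ.children.modify n fun c => (c.1, c.2.add i Δ)) := by rw [add]

theorem data_nil (Γ : NSeq L) : Γ.data [] = some (Γ.fmls, Γ.children.map Prod.fst) := by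
  simp [data, subAt_nil]

theorem data_cons (Γ : NSeq L) (n : ℕ) (x : List ℕ) :
    Γ.data (n :: x) = (Γ.children[n]?).bind fun c => c.2.data x := by
  simp only [data, subAt_cons]
  cases Γ.children[n]? <;> rfl

/-- Nodes, labels and edges depend on a sequent only through `data`. Hence the effect of `add` is
computed once, for `data`, and then transferred to all three. -/
theorem isNode_iff (Γ : NSeq L) (x : List ℕ) : Γ.IsNode x ↔ ∃ d, Γ.data x = some d := by
  simp [IsNode, data]

theorem at'_eq (Γ : NSeq L) (x : List ℕ) : Γ.at' x = ((Γ.data x).map Prod.fst).getD 0 := by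
  unfold at' data
  cases Γ.subAt x <;> rfl

theorem edge_iff (Γ : NSeq L) (x : List ℕ) (a : L) (y : List ℕ) :
    Γ.Edge x a y ↔ ∃ d n, Γ.data x = some d ∧ d.2[n]? = some a ∧ y = x ++ [n] := by
  constructor
  · rintro ⟨Δ, n, c, h, h', rfl⟩
    exact ⟨_, n, by rw [data, h]; rfl, by simp [h'], rfl⟩
  · rintro ⟨d, n, h, h', rfl⟩
    simp only [data, Option.map_eq_some_iff] at h
    obtain ⟨Δ, hΔ, rfl⟩ := h
    simp only [List.getElem?_map, Option.map_eq_some_iff] at h'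
    obtain ⟨⟨b, c⟩, hc, rfl⟩ := h'
    exact ⟨Δ, n, c, hΔ, hc, rfl⟩

theorem isNode_of_mem {Γ : NSeq L} {x : List ℕ} {A : Fml L} (h : A ∈ Γ.at' x) : Γ.IsNode x := by
  rw [isNode_iff]
  rw [at'_eq] at h
  cases hd : Γ.data x with
  | none => simp [hd] at h
  | some d => exact ⟨d, rfl⟩

theorem data_child (Γ : NSeq L) (x : List ℕ) (n : ℕ) :
    (∃ e, Γ.data (x ++ [n]) = some e) ↔ ∃ d, Γ.data x = some d ∧ n < d.2.length := by
  induction x generalizing Γ with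
  | nil =>
    simp only [List.nil_append, data_cons, data_nil]
    rcases lt_or_ge n Γ.children.length with h | h
    · simp [h]
    · simp [h]
  | cons m x ih =>
    simp only [List.cons_append, data_cons]
    cases Γ.children[m]? with
    | none => simp
    | some c => simpa using ih c.2

theorem Edge.isNode_left {Γ : NSeq L} {x y : List ℕ} {a : L} (h : Γ.Edge x a y) : Γ.IsNode x := by
  obtain ⟨Δ, _, _, h, _⟩ := h
  exact ⟨Δ, h⟩

theorem Edge.isNode_right {Γ : NSeq L} {x y : List ℕ} {a : L} (h : Γ.Edge x a y) :
    Γ.IsNode y := by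
  rw [edge_iff] at h
  obtain ⟨d, n, hd, hn, rfl⟩ := h
  rw [isNode_iff, data_child]
  exact ⟨d, hd, (List.getElem?_eq_some_iff.1 hn).1⟩

theorem Edge.length {Γ : NSeq L} {x y : List ℕ} {a : L} (h : Γ.Edge x a y) :
    y.length = x.length + 1 := by
  obtain ⟨_, n, _, _, _, rfl⟩ := h
  simp

theorem IsNode.exists_edge {Γ : NSeq L} {x : List ℕ} {n : ℕ} (h : Γ.IsNode (x ++ [n])) :
    ∃ a, Γ.Edge x a (x ++ [n]) := by
  rw [isNode_iff, data_child] at h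
  obtain ⟨d, hd, hn⟩ := h
  exact ⟨d.2[n], (edge_iff ..).2 ⟨d, n, hd, List.getElem?_eq_getElem hn, rfl⟩⟩

theorem isNode_of_prefix {Γ : NSeq L} {x y : List ℕ} (h : Γ.IsNode (x ++ y)) : Γ.IsNode x := by
  induction y using List.reverseRecOn with
  | nil => simpa using h
  | append_singleton y n ih =>
    rw [← List.append_assoc] at h
    obtain ⟨a, e⟩ := h.exists_edge
    exact ih e.isNode_left

/-! ### Effect of adding to a node -/

theorem data_add_cons_nil (fs : Multiset (Fml L)) (cs : List (L × NSeq L)) (n : ℕ)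
    (i : List ℕ) (Δ : NSeq L) :
    ((mk fs cs).add (n :: i) Δ).data [] = some (fs, cs.map Prod.fst) := by
  rw [add_cons, data_nil]
  simp only [fmls, children]
  congr 2
  apply List.ext_getElem?
  intro m
  simp only [List.getElem?_map, List.getElem?_modify]
  cases cs[m]? with
  | none => rfl
  | some c => by_cases h : n = m <;> simp [h]

theorem data_mk_cons (fs : Multiset (Fml L)) (cs : List (L × NSeq L)) (n : ℕ) (x : List ℕ) :
    (mk fs cs).data (n :: x) = (cs[n]?).bind fun c => c.2.data x :=
  data_cons ..

theorem data_add_cons_cons (fs : Multiset (Fml L)) (cs : List (L × NSeq L)) (n m : ℕ)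
    (i : List ℕ) (Δ : NSeq L) (x : List ℕ) :
    ((mk fs cs).add (n :: i) Δ).data (m :: x) =
      (cs[m]?).bind fun c => if n = m then (c.2.add i Δ).data x else c.2.data x := by
  rw [add_cons, data_mk_cons, List.getElem?_modify]
  simp only [children]
  cases cs[m]? with
  | none => rfl
  | some c => by_cases h : n = m <;> simp [h]

theorem data_add_ofFmls (Γ : NSeq L) (i x : List ℕ) (fs : Multiset (Fml L)) :
    (Γ.add i (ofFmls fs)).data x =
      (Γ.data x).map fun d => (if x = i then d.1 + fs else d.1, d.2) := by
  induction i generalizing Γ x with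
  | nil =>
    obtain ⟨gs, cs⟩ := Γ
    cases x with
    | nil => simp [add_nil, data_nil, ofFmls, fmls, children]
    | cons m x =>
      simp only [add_nil, data_mk_cons, ofFmls, children, List.append_nil]
      cases cs[m]? <;> simp
  | cons n i ih =>
    obtain ⟨gs, cs⟩ := Γ
    cases x with
    | nil =>
      rw [data_add_cons_nil]
      simp [data_nil, fmls, children]
    | cons m x =>
      rw [data_add_cons_cons, data_mk_cons]
      cases cs[m]? with
      | none => rfl
      | some c =>
        by_cases h : n = m
        · subst h
          simp [ih]
        · simp [h, Ne.symm h]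

theorem isNode_add_ofFmls {Γ : NSeq L} {i x : List ℕ} {fs : Multiset (Fml L)} :
    (Γ.add i (ofFmls fs)).IsNode x ↔ Γ.IsNode x := by
  rw [isNode_iff, isNode_iff, data_add_ofFmls]
  cases Γ.data x <;> simp

theorem edge_add_ofFmls {Γ : NSeq L} {i x y : List ℕ} {a : L} {fs : Multiset (Fml L)} :
    (Γ.add i (ofFmls fs)).Edge x a y ↔ Γ.Edge x a y := by
  rw [edge_iff, edge_iff, data_add_ofFmls]
  cases Γ.data x <;> simp

theorem mem_add_ofFmls {Γ : NSeq L} {i x : List ℕ} {B : Fml L} {fs : Multiset (Fml L)} :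
    B ∈ (Γ.add i (ofFmls fs)).at' x ↔ B ∈ Γ.at' x ∨ Γ.IsNode x ∧ x = i ∧ B ∈ fs := by
  simp only [at'_eq, data_add_ofFmls, isNode_iff]
  cases Γ.data x with
  | none => simp
  | some d => by_cases h : x = i <;> simp [h]

/-- Children are appended at the end of the list, so the new one gets the old number of children as
its index and no existing address changes. -/
theorem data_add_bracket (Γ : NSeq L) (i x : List ℕ) (a : L) (A : Fml L)
    (m : Multiset (Fml L)) (ls : List L) (hi : Γ.data i = some (m, ls)) :
    (Γ.add i (bracket a A)).data x =
      if x = i then some (m, ls ++ [a]) else if x = i ++ [ls.length] then some ({A}, [])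
      else Γ.data x := by
  induction i generalizing Γ x with
  | nil =>
    obtain ⟨fs, cs⟩ := Γ
    simp only [data_nil, Option.some.injEq, Prod.mk.injEq, fmls, children] at hi
    obtain ⟨rfl, rfl⟩ := hi
    cases x with
    | nil => simp [add_nil, data_nil, bracket, fmls, children]
    | cons n x =>
      simp only [add_nil, data_cons, bracket, children, fmls, List.length_map]
      rcases lt_trichotomy n cs.length with h | h | h
      · rw [List.getElem?_append_left h]
        simp [h.ne]
      · subst h
        cases x with
        | nil => simp [data_nil, ofFmls, fmls, children]
        | cons k x => simp [data_cons, ofFmls, children]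
      · have h1 : cs[n]? = none := List.getElem?_eq_none h.le
        have h2 : (cs ++ [(a, ofFmls {A})])[n]? = none := List.getElem?_eq_none (by simp; omega)
        simp [h1, h2, h.ne']
  | cons n i ih =>
    obtain ⟨gs, cs⟩ := Γ
    rw [data_mk_cons] at hi
    cases x with
    | nil =>
      rw [data_add_cons_nil]
      simp [data_nil, fmls, children]
    | cons k x =>
      rw [data_add_cons_cons, data_mk_cons]
      by_cases h : n = k
      · subst h
        cases hc : cs[n]? with
        | none => simp [hc] at hi
        | some c =>
          rw [hc] at hi
          simp [ih c.2 x hi]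
      · simp [h, Ne.symm h]

/-- The effect of adding a new child to a node. -/
theorem exists_add_bracket {Γ : NSeq L} {i : List ℕ} (hi : Γ.IsNode i) (a : L) (A : Fml L) :
    ∃ n, ¬ Γ.IsNode (i ++ [n]) ∧
      (∀ x, (Γ.add i (bracket a A)).IsNode x ↔ Γ.IsNode x ∨ x = i ++ [n]) ∧
      (∀ x b y, (Γ.add i (bracket a A)).Edge x b y ↔
        Γ.Edge x b y ∨ x = i ∧ b = a ∧ y = i ++ [n]) ∧
      ∀ x B, B ∈ (Γ.add i (bracket a A)).at' x ↔ B ∈ Γ.at' x ∨ x = i ++ [n] ∧ B = A := by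
  obtain ⟨⟨m, ls⟩, hd⟩ := (isNode_iff ..).1 hi
  have key := fun x => data_add_bracket Γ i x a A m ls hd
  have hnew : ¬ Γ.IsNode (i ++ [ls.length]) := by
    rw [isNode_iff, data_child]
    rintro ⟨d, hd', h⟩
    rw [hd] at hd'
    cases hd'
    exact lt_irrefl _ h
  have hnone : Γ.data (i ++ [ls.length]) = none := by
    rw [isNode_iff] at hnew
    exact Option.eq_none_iff_forall_ne_some.2 fun d h => hnew ⟨d, h⟩
  refine ⟨ls.length, hnew, fun x => ?_, fun x b y => ?_, fun x B => ?_⟩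
  · rw [isNode_iff, isNode_iff, key]
    split_ifs with h h'
    · subst h; simp [hd]
    · simp [h']
    · simp [h']
  · rw [edge_iff, edge_iff, key]
    split_ifs with h h'
    · subst h
      constructor
      · rintro ⟨d, n, hd', hn, rfl⟩
        cases hd'
        simp only [List.getElem?_append] at hn
        split_ifs at hn with hlt
        · exact Or.inl ⟨_, n, hd, hn, rfl⟩
        · have : n - ls.length = 0 := by
            by_contra hne
            rw [List.getElem?_eq_none (by simp; omega)] at hn
            cases hn
          have hn' : n = ls.length := by omega
          subst hn'
          simp at hn
          exact Or.inr ⟨rfl, hn.symm, rfl⟩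
      · rintro (⟨d, n, hd', hn, rfl⟩ | ⟨-, rfl, rfl⟩)
        · rw [hd] at hd'
          cases hd'
          refine ⟨_, n, rfl, ?_, rfl⟩
          rw [List.getElem?_append_left (List.getElem?_eq_some_iff.1 hn).1]
          exact hn
        · exact ⟨_, ls.length, rfl, by simp, rfl⟩
    · subst h'
      simp [hnone]
    · simp [h]
  · rw [at'_eq, at'_eq, key]
    split_ifs with h h'
    · subst h; simp [hd]
    · subst h'; simp [hnone]
    · simp [h']

/-! ### One-node sequents, leaves and internal nodes -/

theorem data_ofFmls (fs : Multiset (Fml L)) (x : List ℕ) :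
    (ofFmls fs).data x = if x = [] then some (fs, []) else none := by
  cases x with
  | nil => simp [ofFmls, data_nil, fmls, children]
  | cons n x => simp [ofFmls, data_mk_cons]

theorem isNode_ofFmls {fs : Multiset (Fml L)} {x : List ℕ} :
    (ofFmls fs).IsNode x ↔ x = [] := by
  rw [isNode_iff, data_ofFmls]
  split_ifs with h <;> simp [h]

theorem not_edge_ofFmls {fs : Multiset (Fml L)} {x y : List ℕ} {a : L} :
    ¬ (ofFmls fs).Edge x a y := by
  rw [edge_iff, data_ofFmls]
  split_ifs with h <;> simp

theorem mem_at'_ofFmls {fs : Multiset (Fml L)} {x : List ℕ} {A : Fml L} :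
    A ∈ (ofFmls fs).at' x ↔ x = [] ∧ A ∈ fs := by
  rw [at'_eq, data_ofFmls]
  split_ifs with h <;> simp [h]

theorem internal_or_leaf {Γ : NSeq L} {i : List ℕ} (h : Γ.IsNode i) :
    Γ.Internal i ∨ Γ.Leaf i := by
  by_cases h' : ∃ a j, Γ.Edge i a j
  · exact Or.inl ⟨h, h'⟩
  · exact Or.inr ⟨h, fun a j e => h' ⟨a, j, e⟩⟩

/-- A proper ancestor of a node is an internal node. -/
theorem internal_of_ancestor {Γ : NSeq L} {x y : List ℕ} (h : Ancestor y x) (hx : Γ.IsNode x) :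
    Γ.Internal y := by
  obtain ⟨⟨z, rfl⟩, hne⟩ := h
  cases z with
  | nil => simp at hne
  | cons n z =>
    have h1 : Γ.IsNode (y ++ [n]) := isNode_of_prefix (y := z) (by simpa using hx)
    obtain ⟨a, e⟩ := h1.exists_edge
    exact ⟨e.isNode_left, a, _, e⟩

end NSeq

/-! ### The model generated by labelled steps -/

section ClosureModel

variable {L : Type u} {X : Type}

/-- There is a walk from one state to the other along steps labelled by the letters of the word. -/
def Walk (T : L → X → X → Prop) : List L → X → X → Prop
  | [], x, y => x = y
  | a :: v, x, y => ∃ z, T a x z ∧ Walk T v z y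

theorem walk_append {T : L → X → X → Prop} {u v : List L} {x y : X} :
    Walk T (u ++ v) x y ↔ ∃ z, Walk T u x z ∧ Walk T v z y := by
  induction u generalizing x with
  | nil => simp [Walk]
  | cons a u ih =>
    simp only [List.cons_append, Walk, ih]
    exact ⟨fun ⟨z, h, z', h', h''⟩ => ⟨z', ⟨z, h, h'⟩, h''⟩,
      fun ⟨z', ⟨z, h, h'⟩, h''⟩ => ⟨z, h, z', h', h''⟩⟩

/-- Walks can be concatenated and reversed, and they make sense for any labelled step relation,
including limits of sequents that are not given by an automaton. -/
theorem mem_accepts_iff_walk (P : NFA L X) (v : List L) :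
    v ∈ P.accepts ↔
      ∃ s ∈ P.start, ∃ t ∈ P.accept, Walk (fun a x y => y ∈ P.step x a) v s t := by
  have key : ∀ (v : List L) (A : Set X) (t : X), t ∈ P.evalFrom A v ↔
      ∃ s ∈ A, Walk (fun a x y => y ∈ P.step x a) v s t := by
    intro v
    induction v with
    | nil => intro A t; simp [Walk]
    | cons a v ih =>
      intro A t
      rw [NFA.evalFrom_cons, ih]
      simp only [NFA.mem_stepSet, Walk]
      exact ⟨fun ⟨z, ⟨s, hs, h⟩, h'⟩ => ⟨s, hs, z, h, h'⟩,
        fun ⟨s, hs, z, h, h'⟩ => ⟨z, ⟨s, hs, h⟩, h'⟩⟩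
  rw [NFA.mem_accepts]
  simp only [key]
  exact ⟨fun ⟨t, ht, s, hs, h⟩ => ⟨s, hs, t, ht, h⟩, fun ⟨s, hs, t, ht, h⟩ => ⟨t, ht, s, hs, h⟩⟩

namespace SemiThue

theorem Rewrites.append_left {S : SemiThue L} {v v' : List L} (u : List L)
    (h : S.Rewrites v v') : S.Rewrites (u ++ v) (u ++ v') := by
  obtain ⟨x, y, l, r, hS, rfl, rfl⟩ := h
  exact ⟨u ++ x, y, l, r, hS, by simp, by simp⟩

theorem Rewrites.append_right {S : SemiThue L} {v v' : List L} (u : List L)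
    (h : S.Rewrites v v') : S.Rewrites (v ++ u) (v' ++ u) := by
  obtain ⟨x, y, l, r, hS, rfl, rfl⟩ := h
  exact ⟨x, y ++ u, l, r, hS, by simp, by simp⟩

theorem rewrites_append {S : SemiThue L} {u u' v v' : List L}
    (h : Relation.ReflTransGen S.Rewrites u u') (h' : Relation.ReflTransGen S.Rewrites v v') :
    Relation.ReflTransGen S.Rewrites (u ++ v) (u' ++ v') :=
  (h.lift (· ++ v) fun _ _ => Rewrites.append_right v).trans
    (h'.lift (u' ++ ·) fun _ _ => Rewrites.append_left u')

end SemiThue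

variable [ConverseAlphabet L]

theorem convWord_append (u v : List L) : convWord (u ++ v) = convWord v ++ convWord u := by
  simp [convWord]

theorem Walk.conv {T : L → X → X → Prop} (hT : ∀ a x y, T a x y → T (conv a) y x)
    {v : List L} {x y : X} (h : Walk T v x y) : Walk T (convWord v) y x := by
  induction v generalizing x with
  | nil => exact h.symm
  | cons a v ih =>
    obtain ⟨z, hz, h⟩ := h
    rw [← List.singleton_append, convWord_append]
    exact walk_append.2 ⟨z, ih h, x, hT _ _ _ hz, rfl⟩

/-- Conversion turns a rewriting step into a step by the converse rule, with left and right context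
exchanged. -/
theorem SemiThue.Closed.convWord_mem_lang {S : SemiThue L} (hcl : S.Closed) {a : L}
    {v : List L} (h : v ∈ S.lang a) : convWord v ∈ S.lang (conv a) := by
  have h' : Relation.ReflTransGen S.Rewrites [a] v := h
  refine h'.lift convWord ?_
  rintro _ _ ⟨x, y, l, r, hS, rfl, rfl⟩
  exact ⟨convWord y, convWord x, _, _, hcl l r hS, by simp [convWord_append],
    by simp [convWord_append]⟩

/-- The model whose accessibility relation for `a` consists of the walks labelled by words that
can be produced from `a`. -/
def closureModel (S : SemiThue L) (hcl : S.Closed) (T : L → X → X → Prop)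
    (hT : ∀ a x y, T a x y → T (conv a) y x) (V : ℕ → Set X) : Model L (ULift.{w} X) where
  rel a x y := ∃ v ∈ S.lang a, Walk T v x.down y.down
  rel_conv a x y := by
    constructor
    · rintro ⟨v, hv, h⟩
      exact ⟨_, hcl.convWord_mem_lang hv, h.conv hT⟩
    · rintro ⟨v, hv, h⟩
      have := hcl.convWord_mem_lang hv
      rw [ConverseAlphabet.conv_conv] at this
      exact ⟨_, this, h.conv hT⟩
  val p := {x | x.down ∈ V p}

/-- A path along the letters of `r` concatenates walks whose words are produced from these letters,
so the whole word is produced from `r`. If the rule is `a → r`, it is also produced from `a`. This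
is where a single letter on the left is needed. -/
theorem closureModel_satisfies (S : SemiThue L) (hcf : S.ContextFree) (hcl : S.Closed)
    (T : L → X → X → Prop) (hT : ∀ a x y, T a x y → T (conv a) y x) (V : ℕ → Set X) :
    (closureModel.{u, w} S hcl T hT V).Satisfies S := by
  have key : ∀ (r : List L) (x y : ULift.{w} X), (closureModel S hcl T hT V).wordRel r x y →
      ∃ v, Relation.ReflTransGen S.Rewrites r v ∧ Walk T v x.down y.down := by
    intro r
    induction r with
    | nil =>
      rintro x y rfl
      exact ⟨[], .refl, rfl⟩
    | cons a r ih =>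
      rintro x y ⟨z, ⟨u, hu, h⟩, h'⟩
      obtain ⟨v, hv, h'⟩ := ih z y h'
      exact ⟨u ++ v, SemiThue.rewrites_append (u := [a]) hu hv, walk_append.2 ⟨_, h, h'⟩⟩
  intro l r hS x y h
  obtain ⟨a, rfl⟩ := hcf l r hS
  obtain ⟨v, hv, h⟩ := key r x y h
  exact ⟨y, ⟨v, .head ⟨[], [], [a], r, hS, rfl, by simp⟩ hv, h⟩, rfl⟩

/-- A labelling of the states by formulae that can all be false in the generated model. -/
structure Hintikka (S : SemiThue L) (T : L → X → X → Prop) (lab : X → Set (Fml L)) : Prop where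
  symm : ∀ a x y, T a x y → T (conv a) y x
  clash : ∀ x p, Fml.atom p ∈ lab x → Fml.natom p ∉ lab x
  or : ∀ x A B, Fml.or A B ∈ lab x → A ∈ lab x ∧ B ∈ lab x
  and : ∀ x A B, Fml.and A B ∈ lab x → A ∈ lab x ∨ B ∈ lab x
  box : ∀ x a A, Fml.box a A ∈ lab x → ∃ y, T a x y ∧ A ∈ lab y
  dia : ∀ x y a A v, Fml.dia a A ∈ lab x → v ∈ S.lang a → Walk T v x y → A ∈ lab y

/-- Induction on the formula, with an atom true exactly where it is not in the label. For boxes, the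
single step is a walk labelled by `[a]`, which lies in `L_a(S)`; for diamonds, the condition `dia`
quantifies over the very walks that define `R_a`. -/
theorem Hintikka.exists_model {S : SemiThue L} {T : L → X → X → Prop} {lab : X → Set (Fml L)}
    (H : Hintikka S T lab) (hcf : S.ContextFree) (hcl : S.Closed) :
    ∃ M : Model L (ULift.{w} X), M.Satisfies S ∧
      ∀ x, ∀ A ∈ lab x, ¬ M.Sat ⟨x⟩ A := by
  refine ⟨closureModel S hcl T H.symm fun p => {x | Fml.atom p ∉ lab x},
    closureModel_satisfies S hcf hcl _ _ _, fun x A => ?_⟩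
  induction A generalizing x with
  | atom p => exact fun h h' => h' h
  | natom p => exact fun h h' => h' fun h'' => H.clash x p h'' h
  | or A B ihA ihB =>
    intro h h'
    obtain ⟨hA, hB⟩ := H.or x A B h
    exact h'.elim (ihA x hA) (ihB x hB)
  | and A B ihA ihB =>
    intro h h'
    exact (H.and x A B h).elim (fun hA => ihA x hA h'.1) fun hB => ihB x hB h'.2
  | box a A ih =>
    intro h h'
    obtain ⟨y, hT, hA⟩ := H.box x a A h
    exact ih y hA (h' ⟨y⟩ ⟨[a], .refl, y, hT, rfl⟩)
  | dia a A ih =>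
    rintro h ⟨⟨y⟩, ⟨v, hv, hw⟩, h'⟩
    exact ih y (H.dia x y a A v h hv hw) h'

end ClosureModel

/-! ### Countermodels from stable sequents -/

section Countermodels

variable {L : Type u} [ConverseAlphabet L]

/-- The steps along the edges of a sequent in both directions. -/
def treeStep (Γ : NSeq L) (a : L) (x y : List ℕ) : Prop := Γ.Edge x a y ∨ Γ.Edge y (conv a) x

theorem mem_automaton_accepts {Γ : NSeq L} {i j : List ℕ} {v : List L} :
    v ∈ (Γ.automaton i j).accepts ↔ Walk (treeStep Γ) v i j := by
  rw [mem_accepts_iff_walk]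
  exact ⟨fun ⟨_, rfl, _, rfl, h⟩ => h, fun h => ⟨i, rfl, j, rfl, h⟩⟩

theorem isNode_of_walk {Γ : NSeq L} {v : List L} {x y : List ℕ} (hx : Γ.IsNode x)
    (h : Walk (treeStep Γ) v x y) : Γ.IsNode y := by
  induction v generalizing x with
  | nil => exact h ▸ hx
  | cons a v ih =>
    obtain ⟨z, hz, h⟩ := h
    exact ih (hz.elim Edge.isNode_right Edge.isNode_left) h

/-- Each unrealised leaf is folded onto its ancestor `θ x`, which has the same formulae and, being
internal, is realised. The steps become those of the renamed automata, and stability says that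
diamonds are propagated along these. -/
theorem NSeq.Stable.exists_countermodel {S : SemiThue L} (hcf : S.ContextFree) (hcl : S.Closed)
    {Γ : NSeq L} (hΓ : Γ.Stable S) :
    ∃ (W : Type w) (M : Model L W), Nonempty W ∧ M.Satisfies S ∧
      ∀ x, Γ.IsNode x → ∃ v : W, ∀ A ∈ Γ.at' x, ¬ M.Sat v A := by
  obtain ⟨hsat, -, hint, θ, hθ, hid, hdia⟩ := hΓ
  -- `θ` is idempotent: its values at unrealised leaves are proper ancestors, hence internal and
  -- realised, hence fixed.
  have hθθ : ∀ x, θ (θ x) = θ x := fun x => by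
    by_cases hx : Γ.UnrealisedLeaf x
    · exact hid _ fun h => h.2 (hint _ (internal_of_ancestor (hθ x hx).1 hx.1.1))
    · rw [hid x hx, hid x hx]
  have hat : ∀ x, Γ.at' (θ x) = Γ.at' x := fun x => by
    by_cases hx : Γ.UnrealisedLeaf x
    · exact (hθ x hx).2.symm
    · rw [hid x hx]
  have hnode : ∀ x, Γ.IsNode x → Γ.IsNode (θ x) := fun x h => by
    by_cases hx : Γ.UnrealisedLeaf x
    · exact (internal_of_ancestor (hθ x hx).1 h).1
    · rwa [hid x hx]
  have hreal : ∀ x, Γ.IsNode x → θ x = x → Γ.Realised x := fun x h hx => by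
    by_contra hr
    rcases internal_or_leaf h with h' | h'
    · exact hr (hint x h')
    · exact (hθ x ⟨h', hr⟩).1.2 hx
  let T : L → List ℕ → List ℕ → Prop := fun a x y =>
    ∃ x' y', θ x' = x ∧ θ y' = y ∧ treeStep Γ a x' y'
  have hwalk : ∀ (v : List L) (x y : List ℕ), Γ.IsNode x → θ x = x → Walk T v x y →
      Γ.IsNode y ∧ θ y = y := by
    intro v
    induction v with
    | nil =>
      rintro x y h h' rfl
      exact ⟨h, h'⟩
    | cons a v ih =>
      rintro x y - - ⟨z, ⟨x', z', rfl, rfl, hs⟩, h⟩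
      exact ih _ y (hnode _ (hs.elim Edge.isNode_right Edge.isNode_left)) (hθθ _) h
  -- Addresses that `θ` moves get the empty label, so the conditions on labels concern fixed nodes
  -- only.
  have H : Hintikka S T fun x => {A | θ x = x ∧ A ∈ Γ.at' x} := by
    constructor
    · rintro a _ _ ⟨x, y, rfl, rfl, h | h⟩
      · exact ⟨y, x, rfl, rfl, Or.inr (by rwa [ConverseAlphabet.conv_conv])⟩
      · exact ⟨y, x, rfl, rfl, Or.inl h⟩
    · rintro x p ⟨-, h⟩ ⟨-, h'⟩
      exact (hsat x (isNode_of_mem h)).1 _ h h'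
    · rintro x A B ⟨hx, h⟩
      have := (hsat x (isNode_of_mem h)).2.1 A B h
      exact ⟨⟨hx, this.1⟩, hx, this.2⟩
    · rintro x A B ⟨hx, h⟩
      exact ((hsat x (isNode_of_mem h)).2.2 A B h).imp (⟨hx, ·⟩) (⟨hx, ·⟩)
    · rintro x a A ⟨hx, h⟩
      obtain ⟨y, e, hy⟩ := hreal x (isNode_of_mem h) hx a A h
      exact ⟨θ y, ⟨x, y, hx, rfl, Or.inl e⟩, hθθ y, by rwa [hat]⟩
    · rintro x y a A v ⟨hx, h⟩ hv hw
      have hxn := isNode_of_mem h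
      obtain ⟨hy, hθy⟩ := hwalk v x y hxn hx hw
      refine ⟨hθy, hdia x y hxn hy x ⟨x, rfl, hx⟩ y ⟨y, rfl, hθy⟩ a A h ⟨v, ?_, hv⟩⟩
      rw [mem_accepts_iff_walk]
      exact ⟨x, ⟨x, rfl, hx⟩, y, ⟨y, rfl, hθy⟩, hw⟩
  obtain ⟨M, hM, h⟩ := H.exists_model hcf hcl
  refine ⟨_, M, ⟨⟨[]⟩⟩, hM, fun x _ => ⟨⟨θ x⟩, fun A hA => h _ A ⟨hθθ x, by rwa [hat]⟩⟩⟩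

/-- A sequence of sequents that contain `F`, without clash and without local and propagation
tasks, and realised up to growing heights, gives a countermodel to `F`. -/
theorem not_sValid_of_forall_noLeafTask {S : SemiThue L} (hcf : S.ContextFree) (hcl : S.Closed)
    {F : Fml L} (Γ : ℕ → NSeq L) (hF : ∀ k, F ∈ (Γ k).at' [])
    (hΓ : ∀ k, NoLeafTask S k (Γ k)) : ¬ SValid.{u, w} S F := by
  -- The ultrafilter contains all final segments of `ℕ`, so a property that needs `k` to be large
  -- holds almost everywhere. Worlds of the limit are sequences of addresses, one in each `Γ k`.
  let U : Ultrafilter ℕ := Filter.hyperfilter ℕ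
  have hU : ∀ n, ∀ᶠ k in (U : Filter ℕ), n ≤ k := fun n =>
    (Filter.Tendsto.eventually_ge_atTop Filter.tendsto_id n).filter_mono
      Nat.hyperfilter_le_atTop
  let T : L → (ℕ → List ℕ) → (ℕ → List ℕ) → Prop := fun a x y =>
    ∀ᶠ k in (U : Filter ℕ), treeStep (Γ k) a (x k) (y k)
  -- Only sequences of bounded height carry labels: for them the height is eventually at most `k`,
  -- so the absence of leaf tasks in `Γ k` applies. A step raises the height by at most one, and
  -- words are finite, so walks preserve boundedness.
  let Bd : (ℕ → List ℕ) → Prop := fun x => ∃ h, ∀ᶠ k in (U : Filter ℕ), (x k).length ≤ h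
  have hlen : ∀ k a x y, treeStep (Γ k) a x y → y.length ≤ x.length + 1 := by
    rintro k a x y (h | h)
    · exact h.length.le
    · have := h.length
      omega
  have hBd : ∀ a x y, Bd x → T a x y → Bd y := by
    rintro a x y ⟨h, hx⟩ hT
    refine ⟨h + 1, ?_⟩
    filter_upwards [hx, hT] with k h1 h2
    have := hlen k a _ _ h2
    omega
  have hwalk : ∀ (v : List L) (x y : ℕ → List ℕ), Bd x → Walk T v x y →
      Bd y ∧ ∀ᶠ k in (U : Filter ℕ), Walk (treeStep (Γ k)) v (x k) (y k) := by
    intro v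
    induction v with
    | nil =>
      rintro x y h rfl
      exact ⟨h, .of_forall fun _ => rfl⟩
    | cons a v ih =>
      rintro x y h ⟨z, hz, h'⟩
      obtain ⟨h1, h2⟩ := ih z y (hBd a x z h hz) h'
      refine ⟨h1, ?_⟩
      filter_upwards [hz, h2] with k hz h2
      exact ⟨z k, hz, h2⟩
  have H : Hintikka S T fun x =>
      {A | Bd x ∧ ∀ᶠ k in (U : Filter ℕ), A ∈ (Γ k).at' (x k)} := by
    constructor
    · intro a x y h
      filter_upwards [h] with k h
      rcases h with h | h
      · exact Or.inr (by rwa [ConverseAlphabet.conv_conv])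
      · exact Or.inl h
    · rintro x p ⟨-, h⟩ ⟨-, h'⟩
      obtain ⟨k, h, h'⟩ := (h.and h').exists
      exact (hΓ k).1.1.1.1.1 ⟨_, p, h, h'⟩
    · rintro x A B ⟨hx, h⟩
      have key : ∀ᶠ k in (U : Filter ℕ), A ∈ (Γ k).at' (x k) ∧ B ∈ (Γ k).at' (x k) := by
        filter_upwards [h] with k h
        by_contra hn
        exact (hΓ k).1.1.1.2.1 (x k) A B ⟨h, by tauto⟩
      exact ⟨⟨hx, key.mono fun _ h => h.1⟩, hx, key.mono fun _ h => h.2⟩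
    · rintro x A B ⟨hx, h⟩
      have key : ∀ᶠ k in (U : Filter ℕ), A ∈ (Γ k).at' (x k) ∨ B ∈ (Γ k).at' (x k) := by
        filter_upwards [h] with k h
        by_contra hn
        exact (hΓ k).1.1.1.2.2 (x k) A B ⟨h, by tauto⟩
      -- The conjunct chosen may vary with `k`; an ultrafilter makes one of the two choices hold
      -- almost everywhere.
      exact (Ultrafilter.eventually_or.1 key).imp (⟨hx, ·⟩) (⟨hx, ·⟩)
    · rintro x a A ⟨⟨n, hx⟩, h⟩
      have key : ∀ᶠ k in (U : Filter ℕ), ∃ y, (Γ k).Edge (x k) a y ∧ A ∈ (Γ k).at' y := by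
        filter_upwards [h, hx, hU n] with k h hx hk
        by_contra hn
        push Not at hn
        rcases internal_or_leaf (isNode_of_mem h) with hi | hi
        · exact (hΓ k).1.2 (x k) a A hi ⟨h, hn⟩
        · exact (hΓ k).2 (x k) a A hi (hx.trans hk) ⟨h, hn⟩
      let y : ℕ → List ℕ := fun k => Classical.epsilon fun y =>
        (Γ k).Edge (x k) a y ∧ A ∈ (Γ k).at' y
      have hy : ∀ᶠ k in (U : Filter ℕ), (Γ k).Edge (x k) a (y k) ∧ A ∈ (Γ k).at' (y k) :=
        key.mono fun k hk => Classical.epsilon_spec hk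
      have hT : T a x y := hy.mono fun k h => Or.inl h.1
      exact ⟨y, hT, hBd a x y ⟨n, hx⟩ hT, hy.mono fun k h => h.2⟩
    · rintro x y a A v ⟨hx, h⟩ hv hw
      obtain ⟨hy, hw⟩ := hwalk v x y hx hw
      refine ⟨hy, ?_⟩
      filter_upwards [h, hw] with k h hw
      by_contra hA
      have hxn := isNode_of_mem h
      exact (hΓ k).1.1.2 (x k) (y k) a A ⟨hxn, isNode_of_walk hxn hw, h,
        ⟨v, mem_automaton_accepts.2 hw, hv⟩, hA⟩
  obtain ⟨M, hM, h⟩ := H.exists_model.{u, w} hcf hcl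
  intro hval
  exact h (fun _ => []) F ⟨⟨0, .of_forall fun _ => le_rfl⟩, .of_forall hF⟩ (hval _ M hM _)

end Countermodels

/-! ### Soundness of the calculus -/

section Soundness

variable {L : Type u} [ConverseAlphabet L]

theorem wordRel_append {W : Type w} (M : Model L W) (u v : List L) (x y : W) :
    M.wordRel (u ++ v) x y ↔ ∃ z, M.wordRel u x z ∧ M.wordRel v z y := by
  induction u generalizing x with
  | nil => simp [Model.wordRel]
  | cons a u ih =>
    simp only [List.cons_append, Model.wordRel, ih]
    exact ⟨fun ⟨z, h, z', h', h''⟩ => ⟨z', ⟨z, h, h'⟩, h''⟩,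
      fun ⟨z', ⟨z, h, h'⟩, h''⟩ => ⟨z, h, z', h', h''⟩⟩

/-- Each rule shrinks the relation of the word, so along a derivation the relation of the last word
is contained in that of the first. -/
theorem Model.Satisfies.wordRel_of_rewrites {W : Type w} {M : Model L W} {S : SemiThue L}
    (hM : M.Satisfies S) {u v : List L} (h : Relation.ReflTransGen S.Rewrites u v) {x y : W}
    (hv : M.wordRel v x y) : M.wordRel u x y := by
  induction h with
  | refl => exact hv
  | tail _ h ih =>
    obtain ⟨p, q, l, r, hS, rfl, rfl⟩ := h
    apply ih
    simp only [wordRel_append] at hv ⊢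
    obtain ⟨z, ⟨z', h1, h2⟩, h3⟩ := hv
    exact ⟨z, ⟨z', h1, hM l r hS _ _ h2⟩, h3⟩

theorem Model.Satisfies.rel_of_mem_lang {W : Type w} {M : Model L W} {S : SemiThue L}
    (hM : M.Satisfies S) {a : L} {v : List L} (h : v ∈ S.lang a) {x y : W}
    (hv : M.wordRel v x y) : M.rel a x y := by
  obtain ⟨z, hz, rfl⟩ := hM.wordRel_of_rewrites h hv
  exact hz

/-- The map from nodes to worlds respects the edges, and makes all formulae false. -/
def Refutes {W : Type w} (M : Model L W) (Γ : NSeq L) (f : List ℕ → W) : Prop :=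
  (∀ x a y, Γ.Edge x a y → M.rel a (f x) (f y)) ∧ ∀ x, ∀ A ∈ Γ.at' x, ¬ M.Sat (f x) A

theorem Refutes.add_ofFmls {W : Type w} {M : Model L W} {Γ : NSeq L} {f : List ℕ → W}
    (h : Refutes M Γ f) {i : List ℕ} {fs : Multiset (Fml L)}
    (hfs : ∀ A ∈ fs, ¬ M.Sat (f i) A) : Refutes M (Γ.add i (ofFmls fs)) f := by
  refine ⟨fun x a y e => h.1 x a y (edge_add_ofFmls.1 e), fun x A hA => ?_⟩
  rcases mem_add_ofFmls.1 hA with hA | ⟨-, rfl, hA'⟩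
  · exact h.2 x A hA
  · exact hfs A hA'

theorem Refutes.add_bracket {W : Type w} {M : Model L W} {Γ : NSeq L} {f : List ℕ → W}
    (h : Refutes M Γ f) {i : List ℕ} {a : L} {A : Fml L} (hi : Γ.IsNode i) {w : W}
    (hw : M.rel a (f i) w) (hA : ¬ M.Sat w A) :
    ∃ f', Refutes M (Γ.add i (bracket a A)) f' := by
  obtain ⟨n, hn, -, hedge, hat⟩ := exists_add_bracket hi a A
  have hold : ∀ x, Γ.IsNode x → Function.update f (i ++ [n]) w x = f x := fun x hx => by
    rw [Function.update_of_ne]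
    rintro rfl
    exact hn hx
  refine ⟨Function.update f (i ++ [n]) w, fun x b y e => ?_, fun x B hB => ?_⟩
  · rcases (hedge x b y).1 e with e | ⟨rfl, rfl, rfl⟩
    · rw [hold x e.isNode_left, hold y e.isNode_right]
      exact h.1 x b y e
    · rw [hold _ hi, Function.update_self]
      exact hw
  · rcases (hat x B).1 hB with hB | ⟨rfl, rfl⟩
    · rw [hold x (isNode_of_mem hB)]
      exact h.2 x B hB
    · rwa [Function.update_self]

theorem Refutes.wordRel {W : Type w} {M : Model L W} {Γ : NSeq L} {f : List ℕ → W}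
    (h : Refutes M Γ f) {v : List L} {x y : List ℕ} (hw : Walk (treeStep Γ) v x y) :
    M.wordRel v (f x) (f y) := by
  induction v generalizing x with
  | nil => exact congrArg f hw
  | cons a v ih =>
    obtain ⟨z, hz, hw⟩ := hw
    refine ⟨f z, ?_, ih hw⟩
    rcases hz with e | e
    · exact h.1 x a z e
    · exact (M.rel_conv a _ _).2 (h.1 z _ x e)

/-- Induction on the derivation: a refutation of the conclusion yields one of some premise. Only the
box rule needs a new world, for the new child. For the propagation rule, a walk with a word in
`L_a(S)` is mapped into `R_a`. -/
theorem not_refutes_of_dkm {S : SemiThue L} {W : Type w} {M : Model L W} (hM : M.Satisfies S)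
    {Γ : NSeq L} (hΓ : DKm S Γ) (f : List ℕ → W) : ¬ Refutes M Γ f := by
  induction hΓ generalizing f with
  | id_d Γ i p h h' =>
    intro hf
    exact hf.2 i _ h' fun h'' => hf.2 i _ h h''
  | and_d Γ i A B h _ _ ih₁ ih₂ =>
    intro hf
    refine hf.2 i _ h ⟨?_, ?_⟩
    · by_contra hA
      exact ih₁ f (hf.add_ofFmls (by simpa using hA))
    · by_contra hB
      exact ih₂ f (hf.add_ofFmls (by simpa using hB))
  | or_d Γ i A B h _ ih =>
    intro hf
    have hAB := hf.2 i _ h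
    simp only [Model.Sat, not_or] at hAB
    exact ih f (hf.add_ofFmls (by simpa using hAB))
  | box_d Γ i a A h _ ih =>
    intro hf
    have hA := hf.2 i _ h
    simp only [Model.Sat, not_forall] at hA
    obtain ⟨w, hw, hA⟩ := hA
    obtain ⟨f', hf'⟩ := hf.add_bracket (isNode_of_mem h) hw hA
    exact ih f' hf'
  | dia_up Γ i j a A e h _ ih =>
    intro hf
    refine ih f (hf.add_ofFmls ?_)
    simpa using fun hA => hf.2 i _ h ⟨_, hf.1 i a j e, hA⟩
  | dia_down Γ i j a A e h _ ih =>
    intro hf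
    refine ih f (hf.add_ofFmls ?_)
    simpa using fun hA => hf.2 j _ h ⟨_, (M.rel_conv a _ _).1 (hf.1 i a j e), hA⟩
  | prop_S Γ i j a A hi hj h hL _ ih =>
    intro hf
    obtain ⟨v, hv, hL⟩ := hL
    refine ih f (hf.add_ofFmls ?_)
    simpa using fun hA => hf.2 i _ h
      ⟨_, hM.rel_of_mem_lang hL (hf.wordRel (mem_automaton_accepts.1 hv)), hA⟩

theorem sValid_of_dkm {S : SemiThue L} {F : Fml L} (h : DKm S (ofFmls {F})) :
    SValid.{u, w} S F := by
  intro W M hM x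
  by_contra hx
  refine not_refutes_of_dkm hM h (fun _ => x) ⟨fun _ _ _ e => absurd e not_edge_ofFmls, ?_⟩
  intro i A hA
  obtain ⟨-, hA⟩ := mem_at'_ofFmls.1 hA
  rwa [Multiset.mem_singleton.1 hA]

end Soundness

/-! ### Termination of the bounded procedure -/

section Termination

variable {L : Type u}

/-- The set of subformulae. -/
def Fml.sub : Fml L → Set (Fml L)
  | atom p => {atom p}
  | natom p => {natom p}
  | or A B => insert (or A B) (A.sub ∪ B.sub)
  | and A B => insert (and A B) (A.sub ∪ B.sub)
  | box a A => insert (box a A) A.sub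
  | dia a A => insert (dia a A) A.sub

theorem Fml.finite_sub (A : Fml L) : A.sub.Finite := by
  induction A with
  | atom p => exact Set.finite_singleton _
  | natom p => exact Set.finite_singleton _
  | or A B ihA ihB => exact (ihA.union ihB).insert _
  | and A B ihA ihB => exact (ihA.union ihB).insert _
  | box a A ih => exact ih.insert _
  | dia a A ih => exact ih.insert _

theorem Fml.self_mem_sub (A : Fml L) : A ∈ A.sub := by
  cases A <;> simp [sub]

theorem Fml.sub_subset {A B : Fml L} (h : B ∈ A.sub) : B.sub ⊆ A.sub := by
  induction A with
  | atom p => rw [Set.mem_singleton_iff.1 h]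
  | natom p => rw [Set.mem_singleton_iff.1 h]
  | or A₁ A₂ ih₁ ih₂ =>
    rcases h with rfl | h | h
    · exact subset_rfl
    · exact fun C hC => Or.inr (Or.inl (ih₁ h hC))
    · exact fun C hC => Or.inr (Or.inr (ih₂ h hC))
  | and A₁ A₂ ih₁ ih₂ =>
    rcases h with rfl | h | h
    · exact subset_rfl
    · exact fun C hC => Or.inr (Or.inl (ih₁ h hC))
    · exact fun C hC => Or.inr (Or.inr (ih₂ h hC))
  | box a A ih =>
    rcases h with rfl | h
    · exact subset_rfl
    · exact fun C hC => Or.inr (ih h hC)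
  | dia a A ih =>
    rcases h with rfl | h
    · exact subset_rfl
    · exact fun C hC => Or.inr (ih h hC)

/-- The invariant of the bounded procedure: formulae come from the set `C`, heights are at most
`k + 1`, and the children of a node can be charged to distinct boxes in `C`. -/
structure Bounded (C : Set (Fml L)) (k : ℕ) (Γ : NSeq L) : Prop where
  mem : ∀ x, ∀ A ∈ Γ.at' x, A ∈ C
  height : ∀ x, Γ.IsNode x → x.length ≤ k + 1
  charge : ∃ g : List ℕ → Fml L,
    (∀ x a y, Γ.Edge x a y → Fml.box a (g y) ∈ C ∧ g y ∈ Γ.at' y) ∧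
    ∀ x a y z, Γ.Edge x a y → Γ.Edge x a z → g y = g z → y = z

theorem Bounded.add_ofFmls {C : Set (Fml L)} {k : ℕ} {Γ : NSeq L} (h : Bounded C k Γ)
    (i : List ℕ) {fs : Multiset (Fml L)} (hfs : ∀ A ∈ fs, A ∈ C) :
    Bounded C k (Γ.add i (ofFmls fs)) := by
  obtain ⟨g, hg, hinj⟩ := h.charge
  refine ⟨fun x A hA => ?_, fun x hx => h.height x (isNode_add_ofFmls.1 hx), g,
    fun x a y e => ?_, fun x a y z e e' => ?_⟩
  · rcases mem_add_ofFmls.1 hA with hA | ⟨-, -, hA⟩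
    · exact h.mem x A hA
    · exact hfs A hA
  · have := hg x a y (edge_add_ofFmls.1 e)
    exact ⟨this.1, mem_add_ofFmls.2 (Or.inl this.2)⟩
  · exact hinj x a y z (edge_add_ofFmls.1 e) (edge_add_ofFmls.1 e')

theorem Bounded.add_bracket {C : Set (Fml L)} {k : ℕ} {Γ : NSeq L} (h : Bounded C k Γ)
    (hC : ∀ a A, Fml.box a A ∈ C → A ∈ C)
    {i : List ℕ} (hi : i.length ≤ k) {a : L} {A : Fml L} (t : Γ.BoxTask i a A) :
    Bounded C k (Γ.add i (bracket a A)) := by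
  have hin := isNode_of_mem t.1
  obtain ⟨n, hn, hnode, hedge, hat⟩ := exists_add_bracket hin a A
  obtain ⟨g, hg, hinj⟩ := h.charge
  have hbox := h.mem _ _ t.1
  have hold : ∀ x, Γ.IsNode x → Function.update g (i ++ [n]) A x = g x := fun x hx => by
    rw [Function.update_of_ne]
    rintro rfl
    exact hn hx
  refine ⟨fun x B hB => ?_, fun x hx => ?_, Function.update g (i ++ [n]) A,
    fun x b y e => ?_, fun x b y z e e' => ?_⟩
  · rcases (hat x B).1 hB with hB | ⟨-, rfl⟩
    · exact h.mem x B hB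
    · exact hC a B hbox
  · rcases (hnode x).1 hx with hx | rfl
    · exact h.height x hx
    · simpa using hi
  · rcases (hedge x b y).1 e with e | ⟨rfl, rfl, rfl⟩
    · rw [hold y e.isNode_right]
      have := hg x b y e
      exact ⟨this.1, (hat _ _).2 (Or.inl this.2)⟩
    · rw [Function.update_self]
      exact ⟨hbox, (hat _ _).2 (Or.inr ⟨rfl, rfl⟩)⟩
  · rcases (hedge x b y).1 e with e₁ | ⟨rfl, rfl, rfl⟩ <;>
      rcases (hedge _ _ z).1 e' with e₂ | ⟨h1, h2, rfl⟩
    · rw [hold y e₁.isNode_right, hold z e₂.isNode_right]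
      exact hinj x b y z e₁ e₂
    · subst h1 h2
      rw [hold y e₁.isNode_right, Function.update_self]
      rintro rfl
      -- An older child by an `a`-edge with the same charge `A` would contain `A`, and then the box
      -- would not have been a task.
      exact absurd (hg _ _ _ e₁).2 (t.2 y e₁)
    · rw [hold z e₂.isNode_right, Function.update_self]
      rintro rfl
      exact absurd (hg _ _ _ e₂).2 (t.2 z e₂)
    · exact fun _ => rfl

/-- If `n` is the index of a child, then so are `0, …, n`. Sending each of these children to the box
formed from its edge label and its charge is an injection into `C`, so `n + 1 ≤ C.ncard`. -/
theorem Bounded.lt_ncard {C : Set (Fml L)} (hC : C.Finite) {k : ℕ} {Γ : NSeq L}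
    (h : Bounded C k Γ) {x : List ℕ} (hx : Γ.IsNode x) : ∀ n ∈ x, n < C.ncard := by
  induction x using List.reverseRecOn with
  | nil => simp
  | append_singleton x n ih =>
    intro m hm
    rcases List.mem_append.1 hm with hm | hm
    · exact ih (isNode_of_prefix hx) m hm
    · rw [List.mem_singleton.1 hm]
      obtain ⟨g, hg, hinj⟩ := h.charge
      rw [isNode_iff, data_child] at hx
      obtain ⟨d, hd, hn⟩ := hx
      have hedge : ∀ j : Fin (n + 1), ∃ a, Γ.Edge x a (x ++ [(j : ℕ)]) := fun j =>
        IsNode.exists_edge ((isNode_iff ..).2 ((data_child ..).2 ⟨d, hd, by omega⟩))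
      choose a ha using hedge
      have hf : Function.Injective fun j : Fin (n + 1) => Fml.box (a j) (g (x ++ [(j : ℕ)])) := by
        intro j j' hjj
        obtain ⟨h1, h2⟩ := Fml.box.inj hjj
        have := hinj x (a j) _ _ (ha j) (h1 ▸ ha j') h2
        simpa [Fin.ext_iff] using this
      have hle : Set.ncard (Set.range fun j : Fin (n + 1) =>
          Fml.box (a j) (g (x ++ [(j : ℕ)]))) ≤ C.ncard := by
        refine Set.ncard_le_ncard ?_ hC
        rintro _ ⟨j, rfl⟩
        exact (hg _ _ _ (ha j)).1
      rw [← Set.image_univ, Set.ncard_image_of_injective _ hf, Set.ncard_univ] at hle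
      simp at hle
      omega

theorem finite_addresses (h N : ℕ) : {x : List ℕ | x.length ≤ h ∧ ∀ n ∈ x, n < N}.Finite := by
  refine ((List.finite_length_le (Fin N) h).image (List.map Fin.val)).subset ?_
  rintro x ⟨hx, hN⟩
  refine ⟨x.pmap (fun n hn => (⟨n, hn⟩ : Fin N)) hN, by simpa using hx, ?_⟩
  simp [List.map_pmap]

/-- The nodes and the occurrences of formulae of a sequent. -/
def present (Γ : NSeq L) : Set (List ℕ × Option (Fml L)) :=
  {p | Γ.IsNode p.1 ∧ ∀ A ∈ p.2, A ∈ Γ.at' p.1}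

/-- All that can ever be present in a bounded sequent. -/
def space (C : Set (Fml L)) (k : ℕ) : Set (List ℕ × Option (Fml L)) :=
  {x : List ℕ | x.length ≤ k + 1 ∧ ∀ n ∈ x, n < C.ncard} ×ˢ insert none (some '' C)

theorem Bounded.present_subset {C : Set (Fml L)} (hC : C.Finite) {k : ℕ} {Γ : NSeq L}
    (h : Bounded C k Γ) : present Γ ⊆ space C k := by
  rintro ⟨x, o⟩ ⟨hx, ho⟩
  refine ⟨⟨h.height x hx, h.lt_ncard hC hx⟩, ?_⟩
  cases o with
  | none => exact Or.inl rfl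
  | some A => exact Or.inr ⟨A, h.mem x A (ho A rfl), rfl⟩

theorem present_ssubset_add_ofFmls {Γ : NSeq L} {i : List ℕ} (hi : Γ.IsNode i)
    {fs : Multiset (Fml L)} {A : Fml L} (hA : A ∈ fs) (hA' : A ∉ Γ.at' i) :
    present Γ ⊂ present (Γ.add i (ofFmls fs)) := by
  refine Set.ssubset_iff_exists.2 ⟨fun p hp => ⟨isNode_add_ofFmls.2 hp.1, fun B hB =>
    mem_add_ofFmls.2 (Or.inl (hp.2 B hB))⟩, ⟨i, some A⟩, ⟨isNode_add_ofFmls.2 hi, ?_⟩, ?_⟩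
  · rintro B ⟨⟩
    exact mem_add_ofFmls.2 (Or.inr ⟨hi, rfl, hA⟩)
  · exact fun h => hA' (h.2 A rfl)

theorem present_ssubset_add_bracket {Γ : NSeq L} {i : List ℕ} (hi : Γ.IsNode i) (a : L)
    (A : Fml L) : present Γ ⊂ present (Γ.add i (bracket a A)) := by
  obtain ⟨n, hn, hnode, -, hat⟩ := exists_add_bracket hi a A
  refine Set.ssubset_iff_exists.2 ⟨fun p hp => ⟨(hnode _).2 (Or.inl hp.1), fun B hB =>
    (hat _ _).2 (Or.inl (hp.2 B hB))⟩, ⟨i ++ [n], none⟩, ⟨(hnode _).2 (Or.inr rfl), ?_⟩, ?_⟩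
  · rintro B ⟨⟩
  · exact fun h => hn h.1

variable [ConverseAlphabet L]

/-- A recursive call enlarges the sequent. -/
theorem present_ssubset_of_calls {S : SemiThue L} {k : ℕ} {Γ Γ' : NSeq L}
    (h : Calls S k Γ Γ') : present Γ ⊂ present Γ' := by
  rcases h with h | ⟨Δ, h | h⟩
  · cases h with
    | or _ i A B t =>
      rcases t.2 with hA | hB
      · exact present_ssubset_add_ofFmls (isNode_of_mem t.1) (A := A) (by simp) hA
      · exact present_ssubset_add_ofFmls (isNode_of_mem t.1) (A := B) (by simp) hB
    | dia _ i j a A t =>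
      exact present_ssubset_add_ofFmls t.2.1 (Multiset.mem_singleton_self A) t.2.2.2.2
    | boxInternal _ i a A hi t => exact present_ssubset_add_bracket hi.1 a A
    | boxLeaf _ i a A hi hk t => exact present_ssubset_add_bracket hi.1 a A
  · cases h with
    | and _ i A B t =>
      exact present_ssubset_add_ofFmls (isNode_of_mem t.1) (Multiset.mem_singleton_self A) t.2.1
  · cases h with
    | and _ i A B t =>
      exact present_ssubset_add_ofFmls (isNode_of_mem t.1) (Multiset.mem_singleton_self B) t.2.2

theorem Bounded.of_calls {S : SemiThue L} {F : Fml L} {k : ℕ} {Γ Γ' : NSeq L}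
    (hΓ : Bounded F.sub k Γ) (h : Calls S k Γ Γ') : Bounded F.sub k Γ' := by
  have hsub : ∀ A B, A ∈ F.sub → B ∈ A.sub → B ∈ F.sub := fun A B hA hB => Fml.sub_subset hA hB
  have hbox : ∀ a A, Fml.box a A ∈ F.sub → A ∈ F.sub := fun a A hA =>
    hsub _ _ hA (Or.inr A.self_mem_sub)
  rcases h with h | ⟨Δ, h | h⟩
  · cases h with
    | or _ i A B t =>
      have := hΓ.mem _ _ t.1
      refine hΓ.add_ofFmls i fun D hD => ?_
      simp only [Multiset.insert_eq_cons, Multiset.mem_cons, Multiset.mem_singleton] at hD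
      rcases hD with rfl | rfl
      · exact hsub _ _ this (Or.inr (Or.inl D.self_mem_sub))
      · exact hsub _ _ this (Or.inr (Or.inr D.self_mem_sub))
    | dia _ i j a A t =>
      refine hΓ.add_ofFmls j fun D hD => ?_
      rw [Multiset.mem_singleton.1 hD]
      exact hsub _ _ (hΓ.mem _ _ t.2.2.1) (Or.inr A.self_mem_sub)
    | boxInternal _ i a A hi t =>
      -- An internal node has a child of height at most `k + 1`, so its own height is at most `k`
      -- although the procedure does not test it.
      obtain ⟨-, b, j, e⟩ := hi
      have := hΓ.height j e.isNode_right
      rw [e.length] at this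
      exact hΓ.add_bracket hbox (by omega) t
    | boxLeaf _ i a A hi hk t => exact hΓ.add_bracket hbox hk t
  · cases h with
    | and _ i A B t =>
      refine hΓ.add_ofFmls i fun D hD => ?_
      rw [Multiset.mem_singleton.1 hD]
      exact hsub _ _ (hΓ.mem _ _ t.1) (Or.inr (Or.inl A.self_mem_sub))
  · cases h with
    | and _ i A B t =>
      refine hΓ.add_ofFmls i fun D hD => ?_
      rw [Multiset.mem_singleton.1 hD]
      exact hsub _ _ (hΓ.mem _ _ t.1) (Or.inr (Or.inr B.self_mem_sub))

/-- The part of `space` that is not yet present is finite and loses an element with each call, so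
its cardinality is a termination measure. -/
theorem prove₂Terminates (S : SemiThue L) (F : Fml L) (k : ℕ) :
    Prove₂Terminates S k (ofFmls {F}) := by
  have hfin : (space F.sub k).Finite :=
    (finite_addresses _ _).prod ((F.finite_sub.image some).insert none)
  have key : ∀ n Γ, Bounded F.sub k Γ → (space F.sub k \ present Γ).ncard = n →
      Prove₂Terminates S k Γ := by
    intro n
    induction n using Nat.strong_induction_on with
    | _ n ih =>
      rintro Γ hΓ rfl
      refine Acc.intro _ fun Γ' h => ?_
      have hΓ' := hΓ.of_calls h
      refine ih _ (Set.ncard_lt_ncard ?_ (hfin.sdiff ..)) Γ' hΓ' rfl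
      have hss := present_ssubset_of_calls h
      obtain ⟨p, hp, hp'⟩ := Set.exists_of_ssubset hss
      exact Set.ssubset_iff_exists.2 ⟨Set.sdiff_subset_sdiff_right hss.subset, p,
        ⟨hΓ'.present_subset F.finite_sub hp, hp'⟩, fun h => h.2 hp⟩
  refine key _ _ ⟨fun x A hA => ?_, fun x hx => ?_, fun _ => F, ?_, ?_⟩ rfl
  · rw [Multiset.mem_singleton.1 (mem_at'_ofFmls.1 hA).2]
    exact F.self_mem_sub
  · simp [isNode_ofFmls.1 hx]
  · exact fun _ _ _ e => absurd e not_edge_ofFmls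
  · exact fun _ _ _ _ e => absurd e not_edge_ofFmls

end Termination

/-! ### Correctness of the procedure -/

section Correctness

variable {L : Type u} [ConverseAlphabet L]

theorem exists_step (S : SemiThue L) (k : ℕ) (Γ : NSeq L) : ∃ α, Step S k Γ α := by
  by_cases h1 : Γ.Clash
  · exact ⟨_, .clash h1⟩
  by_cases h2 : Γ.Stable S
  · exact ⟨_, .stable h1 h2⟩
  by_cases h3 : ∃ i A B, Γ.OrTask i A B
  · obtain ⟨i, A, B, t⟩ := h3
    exact ⟨_, .or ⟨h1, h2⟩ i A B t⟩
  by_cases h4 : ∃ i A B, Γ.AndTask i A B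
  · obtain ⟨i, A, B, t⟩ := h4
    exact ⟨_, .and ⟨h1, h2⟩ i A B t⟩
  push Not at h3 h4
  by_cases h5 : ∃ i j a A, Γ.DiaTask S i j a A
  · obtain ⟨i, j, a, A, t⟩ := h5
    exact ⟨_, .dia ⟨⟨h1, h2⟩, h3, h4⟩ i j a A t⟩
  push Not at h5
  by_cases h6 : ∃ i a A, Γ.Internal i ∧ Γ.BoxTask i a A
  · obtain ⟨i, a, A, hi, t⟩ := h6
    exact ⟨_, .boxInternal ⟨⟨⟨h1, h2⟩, h3, h4⟩, h5⟩ i a A hi t⟩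
  push Not at h6
  by_cases h7 : ∃ i a A, Γ.Leaf i ∧ height i ≤ k ∧ Γ.BoxTask i a A
  · obtain ⟨i, a, A, hi, hk, t⟩ := h7
    exact ⟨_, .boxLeaf ⟨⟨⟨⟨h1, h2⟩, h3, h4⟩, h5⟩, h6⟩ i a A hi hk t⟩
  push Not at h7
  exact ⟨_, .star ⟨⟨⟨⟨⟨h1, h2⟩, h3, h4⟩, h5⟩, h6⟩, h7⟩⟩

theorem Prove₂Terminates.exists_result {S : SemiThue L} {k : ℕ} {Γ : NSeq L}
    (h : Prove₂Terminates S k Γ) : ∃ r, Prove₂ S k Γ r := by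
  induction h with
  | intro Γ _ ih =>
    obtain ⟨α, hα⟩ := exists_step S k Γ
    cases α with
    | ret r => exact ⟨r, .ret hα⟩
    | call Γ' =>
      obtain ⟨r, hr⟩ := ih Γ' (Or.inl hα)
      exact ⟨r, .call hα hr⟩
    | fork Γ₁ Γ₂ =>
      obtain ⟨r₁, h₁⟩ := ih Γ₁ (Or.inr ⟨Γ₂, Or.inl hα⟩)
      obtain ⟨r₂, h₂⟩ := ih Γ₂ (Or.inr ⟨Γ₁, Or.inr hα⟩)
      exact ⟨_, .fork hα h₁ h₂⟩

/-- Each call is a backward application of a rule of the calculus, with propagation always by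
`prop_S`, and a fork yields `⊤` only when both of its branches do. -/
theorem dkm_of_prove₂_top {S : SemiThue L} {k : ℕ} {Γ : NSeq L} (h : Prove₂ S k Γ .top) :
    DKm S Γ := by
  generalize hr : Outcome.top = r at h
  induction h with
  | ret h =>
    subst hr
    cases h with
    | clash h =>
      obtain ⟨i, p, h, h'⟩ := h
      exact .id_d _ i p h h'
  | call h _ ih =>
    have ih := ih hr
    cases h with
    | or _ i A B t => exact .or_d _ i A B t.1 ih
    | dia _ i j a A t => exact .prop_S _ i j a A t.1 t.2.1 t.2.2.1 t.2.2.2.1 ih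
    | boxInternal _ i a A _ t => exact .box_d _ i a A t.1 ih
    | boxLeaf _ i a A _ _ t => exact .box_d _ i a A t.1 ih
  | @fork _ _ _ r₁ r₂ h _ _ ih₁ ih₂ =>
    have : r₁ = .top ∧ r₂ = .top := by
      cases r₁ <;> cases r₂ <;> first | exact ⟨rfl, rfl⟩ | cases hr
    have ih₁ := ih₁ this.1.symm
    have ih₂ := ih₂ this.2.symm
    cases h with
    | and _ i A B t => exact .and_d _ i A B t.1 ih₁ ih₂

theorem mem_root_of_calls {S : SemiThue L} {k : ℕ} {Γ Γ' : NSeq L} (h : Calls S k Γ Γ')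
    {A : Fml L} (hA : A ∈ Γ.at' []) : A ∈ Γ'.at' [] :=
  ((present_ssubset_of_calls h).subset
    (show ([], some A) ∈ present Γ from ⟨isNode_of_mem hA, by rintro _ ⟨⟩; exact hA⟩)).2 A rfl

/-- A run that does not return `⊤` has a branch that ends with the same result. -/
theorem exists_branch_of_prove₂ {S : SemiThue L} {k : ℕ} {Γ : NSeq L} {r : Outcome}
    (h : Prove₂ S k Γ r) (hr : r ≠ .top) :
    ∃ Γ', (∀ A ∈ Γ.at' [], A ∈ Γ'.at' []) ∧ Step S k Γ' (.ret r) := by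
  induction h with
  | ret h => exact ⟨_, fun _ => id, h⟩
  | call h _ ih =>
    obtain ⟨Γ', h1, h2⟩ := ih hr
    exact ⟨Γ', fun A hA => h1 A (mem_root_of_calls (Or.inl h) hA), h2⟩
  | @fork _ Γ₁ Γ₂ r₁ r₂ h _ _ ih₁ ih₂ =>
    have : r₁ = r₁.combine r₂ ∨ r₂ = r₁.combine r₂ := by
      cases r₁ <;> cases r₂ <;> simp [Outcome.combine]
    rcases this with h' | h'
    · rw [← h'] at hr ⊢
      obtain ⟨Γ', h1, h2⟩ := ih₁ hr
      exact ⟨Γ', fun A hA => h1 A (mem_root_of_calls (Or.inr ⟨Γ₂, Or.inl h⟩) hA), h2⟩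
    · rw [← h'] at hr ⊢
      obtain ⟨Γ', h1, h2⟩ := ih₂ hr
      exact ⟨Γ', fun A hA => h1 A (mem_root_of_calls (Or.inr ⟨Γ₁, Or.inr h⟩) hA), h2⟩

theorem not_prove₂_bot_of_sValid {S : SemiThue L} (hcf : S.ContextFree) (hcl : S.Closed)
    {F : Fml L} (hF : SValid.{u, w} S F) (k : ℕ) : ¬ Prove₂ S k (ofFmls {F}) .bot := by
  intro h
  obtain ⟨Γ, hΓ, hs⟩ := exists_branch_of_prove₂ h (by simp)
  have hmem := hΓ F (mem_at'_ofFmls.2 ⟨rfl, Multiset.mem_singleton_self F⟩)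
  cases hs with
  | stable _ h =>
    obtain ⟨W, M, -, hM, hx⟩ := NSeq.Stable.exists_countermodel.{u, w} hcf hcl h
    obtain ⟨v, hv⟩ := hx [] (isNode_of_mem hmem)
    exact hv F hmem (hF W M hM v)

/-- Otherwise, for every `k`, a branch ending in `⋆` gives a sequent that still contains `F` at the
root and has no task up to height `k`; these sequents have a countermodel as limit. -/
theorem exists_not_prove₂_star_of_sValid {S : SemiThue L} (hcf : S.ContextFree)
    (hcl : S.Closed) {F : Fml L} (hF : SValid.{u, w} S F) :
    ∃ k, ¬ Prove₂ S k (ofFmls {F}) .star := by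
  by_contra! h
  choose Γ hΓ hs using fun k => exists_branch_of_prove₂ (h k) (by simp)
  refine not_sValid_of_forall_noLeafTask.{u, w} hcf hcl Γ
    (fun k => hΓ k F (mem_at'_ofFmls.2 ⟨rfl, Multiset.mem_singleton_self F⟩)) (fun k => ?_) hF
  cases hs k with
  | star h => exact h

theorem proveAlwaysReturns_of_sValid {S : SemiThue L} (hcf : S.ContextFree)
    (hcl : S.Closed) {F : Fml L} (hF : SValid.{u, w} S F) :
    ProveAlwaysReturns S (ofFmls {F}) .top := by
  obtain ⟨n, hn⟩ := exists_not_prove₂_star_of_sValid hcf hcl hF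
  -- Downwards from a bound `n` that excludes `⋆`: there the loop must stop, and below it a `⋆` only
  -- leads to the next bound.
  refine Nat.decreasingInduction (motive := fun k _ => ProveAlwaysFrom S (ofFmls {F}) .top k)
    (fun k _ ih => ?_) ?_ n.zero_le
  all_goals
    refine ⟨prove₂Terminates S F _, fun r' h h' => ?_, fun h => ?_⟩
    · cases r' with
      | top => rfl
      | bot => exact absurd h (not_prove₂_bot_of_sValid hcf hcl hF _)
      | star => exact absurd rfl h'
    · first | exact ih | exact absurd h hn

theorem ProveAlwaysReturns.proveReturns {S : SemiThue L} {Γ : NSeq L} {r : Outcome}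
    (h : ProveAlwaysReturns S Γ r) : ProveReturns S Γ r := by
  unfold ProveAlwaysReturns at h
  unfold ProveReturns
  generalize 0 = k at h ⊢
  induction h with
  | intro ht hr _ ih =>
    obtain ⟨r', hr'⟩ := ht.exists_result
    by_cases h : r' = .star
    · subst h
      exact .next hr' (ih hr')
    · have := hr r' hr' h
      subst this
      exact .done hr' h

theorem ProveReturns.dkm {S : SemiThue L} {Γ : NSeq L} (h : ProveReturns S Γ .top) :
    DKm S Γ := by
  unfold ProveReturns at h
  generalize 0 = k at h
  induction h with
  | done h _ => exact dkm_of_prove₂_top h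
  | next _ _ ih => exact ih

end Correctness

/-! ### Disjunctive ground rules -/

section GroundRules

variable {α : Type}

/-- A set of facts is closed by the rules `P ⊢ ⋁ Q` if every way of applying them ends in a rule
without conclusions. -/
inductive ClosedBy (R : Set (List α × List α)) : List α → Prop
  | intro (Γ P Q : List α) (h : (P, Q) ∈ R) (hP : ∀ p ∈ P, p ∈ Γ)
      (hQ : ∀ q ∈ Q, ClosedBy R (q :: Γ)) : ClosedBy R Γ

theorem ClosedBy.mono {R : Set (List α × List α)} {Γ Δ : List α} (h : ClosedBy R Γ)
    (hΔ : ∀ p ∈ Γ, p ∈ Δ) : ClosedBy R Δ := by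
  induction h generalizing Δ with
  | intro Γ P Q hR hP _ ih =>
    refine .intro Δ P Q hR (fun p hp => hΔ p (hP p hp)) fun q hq => ih q hq fun p hp => ?_
    rcases List.mem_cons.1 hp with rfl | hp
    · exact List.mem_cons_self
    · exact List.mem_cons_of_mem _ (hΔ p hp)

/-- The set of true facts respects the rules. -/
def Respects (R : Set (List α × List α)) (T : Set α) : Prop :=
  ∀ P Q, (P, Q) ∈ R → (∀ p ∈ P, p ∈ T) → ∃ q ∈ Q, q ∈ T

theorem Respects.not_closedBy {R : Set (List α × List α)} {T : Set α} (hT : Respects R T)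
    {Γ : List α} (hΓ : ∀ p ∈ Γ, p ∈ T) : ¬ ClosedBy R Γ := by
  intro h
  induction h with
  | intro Γ P Q hR hP _ ih =>
    obtain ⟨q, hq, hqT⟩ := hT P Q hR fun p hp => hΓ p (hP p hp)
    refine ih q hq fun p hp => ?_
    rcases List.mem_cons.1 hp with rfl | hp
    · exact hqT
    · exact hΓ p hp

/-- Take a maximal set `T` of facts containing `Γ` and including no closed finite list. If a rule
had true premises but no true conclusion, then by maximality each conclusion `q` would be closed
together with finitely many facts of `T`. All these facts with the premises would form a closed list
inside `T`. -/
theorem exists_respects_of_not_closedBy {R : Set (List α × List α)} {Γ : List α}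
    (h : ¬ ClosedBy R Γ) : ∃ T, Respects R T ∧ ∀ p ∈ Γ, p ∈ T := by
  classical
  let Z : Set (Set α) := {T | ∀ Δ : List α, (∀ p ∈ Δ, p ∈ T) → ¬ ClosedBy R Δ}
  obtain ⟨T, hΓT, hT⟩ := zorn_subset_nonempty Z (fun c hc hchain hne => by
    refine ⟨⋃₀ c, fun Δ hΔ => ?_, fun s hs => Set.subset_sUnion_of_mem hs⟩
    have key : ∀ Δ : List α, (∀ p ∈ Δ, p ∈ ⋃₀ c) → ∃ s ∈ c, ∀ p ∈ Δ, p ∈ s := by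
      intro Δ
      induction Δ with
      | nil =>
        obtain ⟨s, hs⟩ := hne
        exact fun _ => ⟨s, hs, by simp⟩
      | cons p Δ ih =>
        intro hΔ
        obtain ⟨s, hs, h1⟩ := ih fun q hq => hΔ q (List.mem_cons_of_mem _ hq)
        obtain ⟨t, ht, h2⟩ := hΔ p List.mem_cons_self
        rcases hchain.total hs ht with hst | hts
        · refine ⟨t, ht, fun q hq => ?_⟩
          rcases List.mem_cons.1 hq with rfl | hq
          · exact h2
          · exact hst (h1 q hq)
        · refine ⟨s, hs, fun q hq => ?_⟩
          rcases List.mem_cons.1 hq with rfl | hq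
          · exact hts h2
          · exact h1 q hq
    obtain ⟨s, hs, h1⟩ := key Δ hΔ
    exact hc hs Δ h1) {p | p ∈ Γ} (fun Δ hΔ hc => h (hc.mono hΔ))
  refine ⟨T, fun P Q hR hP => ?_, fun p hp => hΓT hp⟩
  by_contra! hQ
  have key : ∀ Q : List α, (∀ q ∈ Q, q ∉ T) →
      ∃ Δ : List α, (∀ p ∈ Δ, p ∈ T) ∧ ∀ q ∈ Q, ClosedBy R (q :: Δ) := by
    intro Q
    induction Q with
    | nil => exact fun _ => ⟨[], by simp, by simp⟩
    | cons q Q ih =>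
      intro hQ
      obtain ⟨Δ, hΔ, h1⟩ := ih fun r hr => hQ r (List.mem_cons_of_mem _ hr)
      have hq : insert q T ∉ Z := fun hZ =>
        hQ q List.mem_cons_self (hT.2 hZ (Set.subset_insert q T) (Set.mem_insert q T))
      simp only [Z, Set.mem_ofPred_eq, not_forall, not_not] at hq
      obtain ⟨Δ', hΔ', h2⟩ := hq
      -- The facts in `Δ'` come from `insert q T`; deleting `q` leaves facts of `T`.
      refine ⟨Δ ++ Δ'.filter (· ≠ q), fun p hp => ?_, fun r hr => ?_⟩
      · rcases List.mem_append.1 hp with hp | hp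
        · exact hΔ p hp
        · simp only [List.mem_filter, decide_eq_true_eq] at hp
          exact (hΔ' p hp.1).resolve_left hp.2
      · rcases List.mem_cons.1 hr with rfl | hr
        · refine h2.mono fun p hp => ?_
          by_cases hpr : p = r <;> simp [hpr, hp]
        · refine (h1 r hr).mono fun p hp => ?_
          rcases List.mem_cons.1 hp with rfl | hp <;> simp [*]
  obtain ⟨Δ, hΔ, h1⟩ := key Q hQ
  refine hT.1 (P ++ Δ) (fun p hp => ?_) (.intro _ P Q hR (by simp +contextual) fun q hq =>
    (h1 q hq).mono fun p hp => ?_)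
  · exact (List.mem_append.1 hp).elim (hP p) (hΔ p)
  · rcases List.mem_cons.1 hp with rfl | hp <;> simp [*]

/-! ### Primitive recursive enumerations of rules -/

section Enumeration

variable [Primcodable α] {R : Set (List α × List α)}

/-- A set of rules that has a primitive recursive enumeration. -/
def RuleEnum (R : Set (List α × List α)) : Prop :=
  ∃ f : ℕ → Option (List α × List α), Primrec f ∧ ∀ r, r ∈ R ↔ ∃ n, f n = some r

theorem ruleEnum_range {β : Type} [Primcodable β] {g : β → List α × List α} (hg : Primrec g) :
    RuleEnum {r | ∃ b, r = g b} := by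
  refine ⟨fun n => (Encodable.decode n : Option β).map g,
    Primrec.option_map Primrec.decode (hg.comp₂ Primrec₂.right), fun r => ?_⟩
  constructor
  · rintro ⟨b, rfl⟩
    exact ⟨Encodable.encode b, by simp⟩
  · rintro ⟨n, h⟩
    obtain ⟨b, -, rfl⟩ := Option.map_eq_some_iff.1 h
    exact ⟨b, rfl⟩

theorem RuleEnum.union {R' : Set (List α × List α)} (h : RuleEnum R) (h' : RuleEnum R') :
    RuleEnum (R ∪ R') := by
  obtain ⟨f, hf, hR⟩ := h
  obtain ⟨f', hf', hR'⟩ := h'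
  refine ⟨fun n => if n.unpair.1 = 0 then f n.unpair.2 else f' n.unpair.2, ?_, fun r => ?_⟩
  · have h2 : Primrec fun n : ℕ => n.unpair.2 := Primrec.snd.comp Primrec.unpair
    exact Primrec.ite (Primrec.eq.comp (Primrec.fst.comp Primrec.unpair) (Primrec.const 0))
      (hf.comp h2) (hf'.comp h2)
  · rw [Set.mem_union, hR, hR']
    constructor
    · rintro (⟨n, hn⟩ | ⟨n, hn⟩)
      · exact ⟨Nat.pair 0 n, by simpa using hn⟩
      · exact ⟨Nat.pair 1 n, by simpa using hn⟩
    · rintro ⟨n, hn⟩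
      beta_reduce at hn
      split_ifs at hn
      · exact Or.inl ⟨_, hn⟩
      · exact Or.inr ⟨_, hn⟩

theorem ruleEnum_iUnion {ι : Type*} [Finite ι] {R : ι → Set (List α × List α)}
    (h : ∀ i, RuleEnum (R i)) : RuleEnum (⋃ i, R i) := by
  have key : ∀ s : Set ι, s.Finite → RuleEnum (⋃ i ∈ s, R i) := by
    intro s hs
    induction s, hs using Set.Finite.induction_on with
    | empty => exact ⟨fun _ => none, Primrec.const none, by simp⟩
    | insert _ _ ih =>
      rw [Set.biUnion_insert]
      exact (h _).union ih
  simpa using key Set.univ Set.finite_univ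

end Enumeration

/-! ### Fair search for closure -/

variable [DecidableEq α]

/-- Treat the `n`-th task in all open branches. -/
def stage (f : ℕ → Option (List α × List α)) (n : ℕ) (B : List (List α)) : List (List α) :=
  -- Only the first component of `n.unpair` selects the rule, so every rule is treated at infinitely
  -- many stages. This makes the search fair.
  (f n.unpair.1).elim B fun r =>
    B.flatMap fun Γ => if ∀ p ∈ r.1, p ∈ Γ then r.2.map (· :: Γ) else [Γ]

/-- Run `m` stages, starting with stage `n`. -/
def stages (f : ℕ → Option (List α × List α)) (n m : ℕ) (B : List (List α)) : List (List α) :=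
  Nat.rec B (fun m B => stage f (n + m) B) m

variable {f : ℕ → Option (List α × List α)}

theorem stages_succ (n m : ℕ) (B : List (List α)) :
    stages f n (m + 1) B = stage f (n + m) (stages f n m B) := rfl

theorem stages_add (n m m' : ℕ) (B : List (List α)) :
    stages f n (m + m') B = stages f (n + m) m' (stages f n m B) := by
  induction m' with
  | zero => rfl
  | succ m' ih => rw [← add_assoc, stages_succ, stages_succ, ih, add_assoc]

theorem stage_append (n : ℕ) (B B' : List (List α)) :
    stage f n (B ++ B') = stage f n B ++ stage f n B' := by
  unfold stage
  cases f n.unpair.1 <;> simp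

theorem stages_append (n m : ℕ) (B B' : List (List α)) :
    stages f n m (B ++ B') = stages f n m B ++ stages f n m B' := by
  induction m with
  | zero => rfl
  | succ m ih => rw [stages_succ, ih, stage_append, ← stages_succ, ← stages_succ]

theorem stages_nil (n m : ℕ) : stages f n m ([] : List (List α)) = [] := by
  simpa using congrArg List.length (stages_append (f := f) n m [] [])

/-- Branches develop independently and an empty list of branches stays empty, so the stage counts of
the finitely many branches can be added up. -/
theorem exists_stages_eq_nil {n : ℕ} {B : List (List α)}
    (h : ∀ Γ ∈ B, ∃ m, stages f n m [Γ] = []) : ∃ m, stages f n m B = [] := by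
  induction B with
  | nil => exact ⟨0, rfl⟩
  | cons Γ B ih =>
    obtain ⟨m, hm⟩ := h Γ List.mem_cons_self
    obtain ⟨m', hm'⟩ := ih fun Δ hΔ => h Δ (List.mem_cons_of_mem _ hΔ)
    refine ⟨m + m', ?_⟩
    rw [← List.singleton_append, stages_append, stages_add, hm, stages_nil, add_comm,
      stages_add, hm', stages_nil]
    rfl

theorem exists_subset_of_mem_stage {n : ℕ} {B : List (List α)} {Δ : List α}
    (h : Δ ∈ stage f n B) : ∃ Γ ∈ B, ∀ p ∈ Γ, p ∈ Δ := by
  unfold stage at h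
  cases hf : f n.unpair.1 with
  | none =>
    rw [hf] at h
    exact ⟨Δ, h, fun _ => id⟩
  | some r =>
    rw [hf] at h
    obtain ⟨Γ, hΓ, h⟩ := List.mem_flatMap.1 h
    refine ⟨Γ, hΓ, fun p hp => ?_⟩
    split_ifs at h
    · obtain ⟨q, -, rfl⟩ := List.mem_map.1 h
      exact List.mem_cons_of_mem _ hp
    · rwa [List.mem_singleton.1 h]

theorem exists_subset_of_mem_stages {n m : ℕ} {B : List (List α)} {Δ : List α}
    (h : Δ ∈ stages f n m B) : ∃ Γ ∈ B, ∀ p ∈ Γ, p ∈ Δ := by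
  induction m generalizing Δ with
  | zero => exact ⟨Δ, h, fun _ => id⟩
  | succ m ih =>
    obtain ⟨Γ, hΓ, h1⟩ := exists_subset_of_mem_stage h
    obtain ⟨Γ', hΓ', h2⟩ := ih hΓ
    exact ⟨Γ', hΓ', fun p hp => h1 p (h2 p hp)⟩

variable {R : Set (List α × List α)}

theorem closedBy_of_stage (hf : ∀ r, r ∈ R ↔ ∃ n, f n = some r) {n : ℕ} {B : List (List α)}
    (h : ∀ Δ ∈ stage f n B, ClosedBy R Δ) : ∀ Γ ∈ B, ClosedBy R Γ := by
  intro Γ hΓ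
  unfold stage at h
  cases hr : f n.unpair.1 with
  | none =>
    rw [hr] at h
    exact h Γ hΓ
  | some r =>
    rw [hr] at h
    simp only [Option.elim_some, List.mem_flatMap] at h
    by_cases hP : ∀ p ∈ r.1, p ∈ Γ
    · refine .intro Γ r.1 r.2 ((hf _).2 ⟨_, hr⟩) hP fun q hq => h _ ⟨Γ, hΓ, ?_⟩
      rw [if_pos hP]
      exact List.mem_map_of_mem hq
    · exact h Γ ⟨Γ, hΓ, by simp [hP]⟩

theorem closedBy_of_stages (hf : ∀ r, r ∈ R ↔ ∃ n, f n = some r) {n m : ℕ}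
    {B : List (List α)} (h : ∀ Δ ∈ stages f n m B, ClosedBy R Δ) : ∀ Γ ∈ B, ClosedBy R Γ := by
  induction m with
  | zero => exact h
  | succ m ih => exact ih (closedBy_of_stage hf h)

theorem exists_stages_of_closedBy (hf : ∀ r, r ∈ R ↔ ∃ n, f n = some r) {Γ : List α}
    (h : ClosedBy R Γ) (n : ℕ) {Δ : List α} (hΔ : ∀ p ∈ Γ, p ∈ Δ) :
    ∃ m, stages f n m [Δ] = [] := by
  induction h generalizing n Δ with
  | intro Γ P Q hR hP _ ih =>
    obtain ⟨k, hk⟩ := (hf _).1 hR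
    -- Stage `Nat.pair k n` treats rule `k` and does not come before the current stage `n`. Until
    -- then the branches only gain facts, so the rule is still applicable.
    obtain ⟨d, hd⟩ := Nat.exists_eq_add_of_le (Nat.right_le_pair k n)
    have key : ∃ m, stages f (n + d + 1) m (stages f n (d + 1) [Δ]) = [] := by
      refine exists_stages_eq_nil fun Θ hΘ => ?_
      rw [stages_succ, ← hd, stage, Nat.unpair_pair, hk, Option.elim_some,
        List.mem_flatMap] at hΘ
      obtain ⟨Γ', hΓ', hΘ⟩ := hΘ
      obtain ⟨Δ', hΔ', hsub⟩ := exists_subset_of_mem_stages hΓ'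
      rw [List.mem_singleton.1 hΔ'] at hsub
      have hΓΓ' : ∀ p ∈ Γ, p ∈ Γ' := fun p hp => hsub p (hΔ p hp)
      rw [if_pos fun p hp => hΓΓ' p (hP p hp)] at hΘ
      obtain ⟨q, hq, rfl⟩ := List.mem_map.1 hΘ
      refine ih q hq _ fun p hp => ?_
      rcases List.mem_cons.1 hp with rfl | hp
      · exact List.mem_cons_self
      · exact List.mem_cons_of_mem _ (hΓΓ' p hp)
    obtain ⟨m, hm⟩ := key
    exact ⟨d + 1 + m, by rw [stages_add, ← add_assoc, hm]⟩

theorem closedBy_iff_exists_stages (hf : ∀ r, r ∈ R ↔ ∃ n, f n = some r) {Γ : List α} :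
    ClosedBy R Γ ↔ ∃ m, stages f 0 m [Γ] = [] :=
  ⟨fun h => exists_stages_of_closedBy hf h 0 fun _ => id, fun ⟨m, hm⟩ =>
    closedBy_of_stages hf (n := 0) (m := m) (B := [Γ]) (by simp [hm]) Γ (by simp)⟩

/-! ### Computability of the search -/

variable [Primcodable α]

theorem primrec_stages (hf : Primrec f) :
    Primrec₂ fun (Γ : List α) (m : ℕ) => stages f 0 m [Γ] := by
  have hmem : PrimrecRel fun (p : α) (Γ : List α) => p ∈ Γ := by
    refine (PrimrecRel.exists_mem_list (R := fun (a p : α) => a = p) Primrec.eq).swap.of_eq ?_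
    simp
  have hall : PrimrecRel fun (P Γ : List α) => ∀ p ∈ P, p ∈ Γ := hmem.forall_mem_list
  have hbr : Primrec₂ fun (r : List α × List α) (Γ : List α) =>
      if ∀ p ∈ r.1, p ∈ Γ then r.2.map (· :: Γ) else [Γ] := by
    refine Primrec.ite (hall.comp (Primrec.fst.comp Primrec.fst) Primrec.snd) ?_ ?_
    · exact Primrec.list_map (Primrec.snd.comp Primrec.fst)
        (Primrec.list_cons.comp₂ Primrec₂.right (Primrec.snd.comp₂ Primrec₂.left))
    · exact Primrec.list_cons.comp Primrec.snd (Primrec.const [])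
  have hst : Primrec₂ fun (n : ℕ) (B : List (List α)) => stage f n B := by
    have h1 : Primrec fun p : ℕ × List (List α) => f p.1.unpair.1 :=
      hf.comp (Primrec.fst.comp (Primrec.unpair.comp Primrec.fst))
    have h2 : Primrec₂ fun (p : ℕ × List (List α)) (r : List α × List α) =>
        p.2.flatMap fun Γ => if ∀ p ∈ r.1, p ∈ Γ then r.2.map (· :: Γ) else [Γ] :=
      Primrec.list_flatMap (Primrec.snd.comp Primrec.fst)
        (hbr.comp₂ (Primrec.snd.comp₂ Primrec₂.left) Primrec₂.right)
    refine (Primrec.option_casesOn h1 Primrec.snd h2).of_eq fun p => ?_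
    change _ = stage f p.1 p.2
    unfold stage
    cases f p.1.unpair.1 <;> rfl
  have := Primrec.nat_rec (α := List α) (f := fun Γ => [Γ])
    (g := fun _ p => stage f p.1 p.2) (Primrec.list_cons.comp Primrec.id (Primrec.const []))
    (hst.comp₂ (Primrec.fst.comp₂ Primrec₂.right) (Primrec.snd.comp₂ Primrec₂.right))
  refine this.of_eq fun Γ m => ?_
  simp only [stages, Nat.zero_add]

theorem RuleEnum.rePred_closedBy {β : Type*} [Primcodable β] (hR : RuleEnum R)
    {g : β → List α} (hg : Primrec g) : REPred fun b => ClosedBy R (g b) := by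
  obtain ⟨f, hf, hfR⟩ := hR
  have h1 : PrimrecPred fun p : β × ℕ => stages f 0 p.2 [g p.1] = [] :=
    Primrec.eq.comp ((primrec_stages hf).comp (hg.comp Primrec.fst) Primrec.snd)
      (Primrec.const [])
  have h2 : Partrec fun b : β => Nat.rfind fun n =>
      Part.some (decide (stages f 0 n [g b] = [])) :=
    Partrec.rfind h1.decide.to_comp.partrec
  refine h2.dom_re.of_eq fun b => ?_
  rw [closedBy_iff_exists_stages hfR]
  refine Nat.rfind_dom.trans ⟨fun ⟨n, h, _⟩ => ⟨n, ?_⟩, fun ⟨n, h⟩ => ⟨n, ?_, fun _ => trivial⟩⟩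
  · exact of_decide_eq_true (Part.mem_some_iff.1 h).symm
  · exact Part.mem_some_iff.2 (decide_eq_true h).symm

end GroundRules

/-! ### Validity as a system of ground rules -/

/-- Facts: a tag, a list of numbers and two Skolem terms. -/
abbrev Fact : Type := ℕ × List ℕ × List (List ℕ) × List (List ℕ)

namespace Fact

/-- The list is the code of a formula. -/
def wf (l : List ℕ) : Fact := (0, l, [], [])

/-- The list is the input. -/
def input (l : List ℕ) : Fact := (1, l, [], [])

/-- The formula with the given code is false at the world named by `x`. -/
def lab (x : List (List ℕ)) (l : List ℕ) : Fact := (2, l, x, [])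

/-- The worlds named by `x` and `y` are related by a word. -/
def rel (v : List ℕ) (x y : List (List ℕ)) : Fact := (3, v, x, y)

theorem primrec_wf {β : Type} [Primcodable β] {f : β → List ℕ} (hf : Primrec f) :
    Primrec fun b => wf (f b) :=
  (Primrec.const 0).pair (hf.pair (Primrec.const ([], [])))

theorem primrec_input {β : Type} [Primcodable β] {f : β → List ℕ} (hf : Primrec f) :
    Primrec fun b => input (f b) :=
  (Primrec.const 1).pair (hf.pair (Primrec.const ([], [])))

theorem primrec_lab {β : Type} [Primcodable β] {g : β → List (List ℕ)} {f : β → List ℕ}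
    (hg : Primrec g) (hf : Primrec f) : Primrec fun b => lab (g b) (f b) :=
  (Primrec.const 2).pair (hf.pair (hg.pair (Primrec.const [])))

theorem primrec_rel {β : Type} [Primcodable β] {f : β → List ℕ} {g h : β → List (List ℕ)}
    (hf : Primrec f) (hg : Primrec g) (hh : Primrec h) :
    Primrec fun b => rel (f b) (g b) (h b) :=
  (Primrec.const 3).pair (hf.pair (hg.pair hh))

end Fact

open GrammarLogic.Fact

section Rules

variable {L : Type u} [ConverseAlphabet L]

/-- The ground rules that describe the failure of a formula in a model. A world that falsifies
the box `B` at the world `x` is named `B :: x`. -/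
inductive FactRule (S : SemiThue L) (c : L → ℕ) : List Fact → List Fact → Prop
  | wf_atom (p : ℕ) : FactRule S c [] [wf [0, p]]
  | wf_natom (p : ℕ) : FactRule S c [] [wf [1, p]]
  | wf_or (A B : List ℕ) : FactRule S c [wf A, wf B] [wf (2 :: (A ++ B))]
  | wf_and (A B : List ℕ) : FactRule S c [wf A, wf B] [wf (3 :: (A ++ B))]
  | wf_box (a : L) (A : List ℕ) : FactRule S c [wf A] [wf (4 :: c a :: A)]
  | wf_dia (a : L) (A : List ℕ) : FactRule S c [wf A] [wf (5 :: c a :: A)]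
  | input (A : List ℕ) : FactRule S c [input A, wf A] [lab [] A]
  | clash (x : List (List ℕ)) (p : ℕ) : FactRule S c [lab x [0, p], lab x [1, p]] []
  | or_left (x : List (List ℕ)) (A B : List ℕ) :
      FactRule S c [lab x (2 :: (A ++ B)), wf A, wf B] [lab x A]
  | or_right (x : List (List ℕ)) (A B : List ℕ) :
      FactRule S c [lab x (2 :: (A ++ B)), wf A, wf B] [lab x B]
  | and (x : List (List ℕ)) (A B : List ℕ) :
      FactRule S c [lab x (3 :: (A ++ B)), wf A, wf B] [lab x A, lab x B]
  | box_lab (a : L) (x : List (List ℕ)) (A : List ℕ) :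
      FactRule S c [lab x (4 :: c a :: A)] [lab ((4 :: c a :: A) :: x) A]
  | box_rel (a : L) (x : List (List ℕ)) (A : List ℕ) :
      FactRule S c [lab x (4 :: c a :: A)] [rel [c a] x ((4 :: c a :: A) :: x)]
  | dia (a : L) (x y : List (List ℕ)) (A : List ℕ) :
      FactRule S c [lab x (5 :: c a :: A), rel [c a] x y] [lab y A]
  | rel_nil (x : List (List ℕ)) : FactRule S c [] [rel [] x x]
  | rel_cons (m : ℕ) (v : List ℕ) (x y z : List (List ℕ)) :
      FactRule S c [rel [m] x y, rel v y z] [rel (m :: v) x z]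
  | rel_conv (a : L) (x y : List (List ℕ)) :
      FactRule S c [rel [c a] x y] [rel [c (conv a)] y x]
  | rel_rule (r : S) (x y : List (List ℕ)) :
      FactRule S c [rel (r.1.2.map c) x y] [rel (r.1.1.map c) x y]

/-- The set of all ground rules. -/
def factRules (S : SemiThue L) (c : L → ℕ) : Set (List Fact × List Fact) :=
  {r | FactRule S c r.1 r.2}

/-! #### The rules can be enumerated -/

theorem ruleEnum_of_primrec {β : Type} [Primcodable β] {P Q : β → List Fact} (hP : Primrec P)
    (hQ : Primrec Q) : RuleEnum {r | ∃ b, r = (P b, Q b)} :=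
  ruleEnum_range (hP.pair hQ)

theorem primrec_cons {β γ : Type} [Primcodable β] [Primcodable γ] {f : β → γ}
    {g : β → List γ} (hf : Primrec f) (hg : Primrec g) : Primrec fun b => f b :: g b :=
  Primrec.list_cons.comp hf hg

theorem primrec_append {β γ : Type} [Primcodable β] [Primcodable γ] {f g : β → List γ}
    (hf : Primrec f) (hg : Primrec g) : Primrec fun b => f b ++ g b :=
  Primrec.list_append.comp hf hg

theorem primrec_self {β : Type} [Primcodable β] : Primrec fun b : β => b :=
  Primrec.id

theorem primrec_fst_of {β γ δ : Type} [Primcodable β] [Primcodable γ] [Primcodable δ]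
    {f : β → γ × δ} (hf : Primrec f) : Primrec fun b => (f b).1 :=
  Primrec.fst.comp hf

theorem primrec_snd_of {β γ δ : Type} [Primcodable β] [Primcodable γ] [Primcodable δ]
    {f : β → γ × δ} (hf : Primrec f) : Primrec fun b => (f b).2 :=
  Primrec.snd.comp hf

/-- Each scheme is a primitive recursive function of lists and numbers once the letter or the rule
of `S` is fixed; finiteness reduces these two parameters to finite unions. -/
theorem ruleEnum_factRules [Finite L] {S : SemiThue L} (hS : S.Finite) (c : L → ℕ) :
    RuleEnum (factRules S c) := by
  have : Finite S := hS
  have key : RuleEnum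
      ({r | ∃ p : ℕ, r = ([], [wf [0, p]])} ∪ ({r | ∃ p : ℕ, r = ([], [wf [1, p]])} ∪
      ({r | ∃ b : List ℕ × List ℕ, r = ([wf b.1, wf b.2], [wf (2 :: (b.1 ++ b.2))])} ∪
      ({r | ∃ b : List ℕ × List ℕ, r = ([wf b.1, wf b.2], [wf (3 :: (b.1 ++ b.2))])} ∪
      ((⋃ a : L, {r | ∃ A : List ℕ, r = ([wf A], [wf (4 :: c a :: A)])}) ∪
      ((⋃ a : L, {r | ∃ A : List ℕ, r = ([wf A], [wf (5 :: c a :: A)])}) ∪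
      ({r | ∃ A : List ℕ, r = ([input A, wf A], [lab [] A])} ∪
      ({r | ∃ b : List (List ℕ) × ℕ, r = ([lab b.1 [0, b.2], lab b.1 [1, b.2]], [])} ∪
      ({r | ∃ b : List (List ℕ) × List ℕ × List ℕ,
        r = ([lab b.1 (2 :: (b.2.1 ++ b.2.2)), wf b.2.1, wf b.2.2], [lab b.1 b.2.1])} ∪
      ({r | ∃ b : List (List ℕ) × List ℕ × List ℕ,
        r = ([lab b.1 (2 :: (b.2.1 ++ b.2.2)), wf b.2.1, wf b.2.2], [lab b.1 b.2.2])} ∪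
      ({r | ∃ b : List (List ℕ) × List ℕ × List ℕ,
        r = ([lab b.1 (3 :: (b.2.1 ++ b.2.2)), wf b.2.1, wf b.2.2],
          [lab b.1 b.2.1, lab b.1 b.2.2])} ∪
      ((⋃ a : L, {r | ∃ b : List (List ℕ) × List ℕ,
        r = ([lab b.1 (4 :: c a :: b.2)], [lab ((4 :: c a :: b.2) :: b.1) b.2])}) ∪
      ((⋃ a : L, {r | ∃ b : List (List ℕ) × List ℕ,
        r = ([lab b.1 (4 :: c a :: b.2)], [rel [c a] b.1 ((4 :: c a :: b.2) :: b.1)])}) ∪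
      ((⋃ a : L, {r | ∃ b : List (List ℕ) × List (List ℕ) × List ℕ,
        r = ([lab b.1 (5 :: c a :: b.2.2), rel [c a] b.1 b.2.1], [lab b.2.1 b.2.2])}) ∪
      ({r | ∃ x : List (List ℕ), r = ([], [rel [] x x])} ∪
      ({r | ∃ b : ℕ × List ℕ × List (List ℕ) × List (List ℕ) × List (List ℕ),
        r = ([rel [b.1] b.2.2.1 b.2.2.2.1, rel b.2.1 b.2.2.2.1 b.2.2.2.2],
          [rel (b.1 :: b.2.1) b.2.2.1 b.2.2.2.2])} ∪
      ((⋃ a : L, {r | ∃ b : List (List ℕ) × List (List ℕ),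
        r = ([rel [c a] b.1 b.2], [rel [c (conv a)] b.2 b.1])}) ∪
      (⋃ s : S, {r | ∃ b : List (List ℕ) × List (List ℕ),
        r = ([rel (s.1.2.map c) b.1 b.2], [rel (s.1.1.map c) b.1 b.2])})))))))))))))))))) := by
    repeat' first
      | with_reducible apply RuleEnum.union
      | (with_reducible apply ruleEnum_iUnion; intro)
      | with_reducible apply ruleEnum_of_primrec
      | with_reducible exact Primrec.const _
      | with_reducible exact primrec_self
      | with_reducible apply primrec_cons
      | with_reducible apply primrec_append
      | with_reducible apply primrec_wf
      | with_reducible apply primrec_input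
      | with_reducible apply primrec_lab
      | with_reducible apply primrec_rel
      | with_reducible apply primrec_fst_of
      | with_reducible apply primrec_snd_of
  convert key using 1
  refine Set.Subset.antisymm ?_ ?_
  · rintro ⟨P, Q⟩ h
    simp only [Set.mem_ofPred_eq, Set.mem_union, Set.mem_iUnion, Prod.mk.injEq, Prod.exists]
    cases h
    all_goals
      repeat first
        | exact ⟨_, _, _, rfl, rfl⟩
        | exact Or.inl ⟨_, rfl, rfl⟩
        | exact Or.inl ⟨_, _, rfl, rfl⟩
        | exact Or.inl ⟨_, _, _, rfl, rfl⟩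
        | exact Or.inl ⟨_, _, _, _, rfl, rfl⟩
        | exact Or.inl ⟨_, _, _, _, _, rfl, rfl⟩
        | apply Or.inr
  · repeat' first
      | with_reducible apply Set.union_subset
      | with_reducible apply Set.iUnion_subset
      | intro
    all_goals
      rename_i h
      obtain ⟨b, rfl⟩ := h
      constructor

end Rules

/-! ### Models and sets of facts that respect the rules -/

section RuleSemantics

variable {L : Type u} [ConverseAlphabet L]

/-- Codes can be read in only one way. -/
theorem Fml.code_append_inj {L : Type u} {c : L → ℕ} (hc : Function.Injective c) {F G : Fml L}
    {v v' : List ℕ} (h : F.code c ++ v = G.code c ++ v') : F = G ∧ v = v' := by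
  induction F generalizing G v v' with
  | atom p => cases G <;> simp [code] at h ⊢ <;> exact h
  | natom p => cases G <;> simp [code] at h ⊢ <;> exact h
  | or A B ihA ihB =>
    cases G <;> simp [code] at h ⊢
    obtain ⟨rfl, h1⟩ := ihA h
    obtain ⟨rfl, rfl⟩ := ihB h1
    simp
  | and A B ihA ihB =>
    cases G <;> simp [code] at h ⊢
    obtain ⟨rfl, h1⟩ := ihA h
    obtain ⟨rfl, rfl⟩ := ihB h1
    simp
  | box a A ih =>
    cases G <;> simp [code] at h ⊢
    obtain ⟨h1, h⟩ := h
    obtain ⟨rfl, rfl⟩ := ih h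
    simp [hc h1]
  | dia a A ih =>
    cases G <;> simp [code] at h ⊢
    obtain ⟨h1, h⟩ := h
    obtain ⟨rfl, rfl⟩ := ih h
    simp [hc h1]

theorem Fml.code_injective {L : Type u} {c : L → ℕ} (hc : Function.Injective c) :
    Function.Injective (Fml.code c) := fun F G h =>
  (code_append_inj hc (v := []) (v' := []) (by simpa using h)).1

/-- The facts that hold in a model whose worlds are named by `f`. -/
def Holds {W : Type w} (M : Model L W) (c : L → ℕ) (l : List ℕ) (f : List (List ℕ) → W) :
    Fact → Prop
  | (0, A, _, _) => ∃ F : Fml L, F.code c = A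
  | (1, A, _, _) => A = l
  | (2, A, x, _) => ∃ F : Fml L, F.code c = A ∧ ¬ M.Sat (f x) F
  | (3, v, x, y) => ∃ u : List L, u.map c = v ∧ M.wordRel u (f x) (f y)
  | _ => False

open Classical in
/-- Names for worlds: `B :: x` names a world that falsifies the box with code `B` at the world
named by `x`, if there is one. -/
noncomputable def nameWorld {W : Type w} (M : Model L W) (c : L → ℕ) (w₀ : W) :
    List (List ℕ) → W
  | [] => w₀
  | B :: x =>
    if h : ∃ w, ∃ a A, (Fml.box a A).code c = B ∧ M.rel a (nameWorld M c w₀ x) w ∧ ¬ M.Sat w A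
    then h.choose else w₀

theorem nameWorld_spec {W : Type w} {M : Model L W} {c : L → ℕ} (hc : Function.Injective c)
    {w₀ : W} {x : List (List ℕ)} {a : L} {A : Fml L}
    (h : ¬ M.Sat (nameWorld M c w₀ x) (.box a A)) :
    M.rel a (nameWorld M c w₀ x) (nameWorld M c w₀ ((Fml.box a A).code c :: x)) ∧
      ¬ M.Sat (nameWorld M c w₀ ((Fml.box a A).code c :: x)) A := by
  have hex : ∃ w, ∃ a' A', (Fml.box a' A').code c = (Fml.box a A).code c ∧
      M.rel a' (nameWorld M c w₀ x) w ∧ ¬ M.Sat w A' := by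
    simp only [Model.Sat, not_forall] at h
    obtain ⟨w, hw, hA⟩ := h
    exact ⟨w, a, A, rfl, hw, hA⟩
  obtain ⟨a', A', he, h1, h2⟩ := hex.choose_spec
  obtain ⟨rfl, rfl⟩ := Fml.box.inj (Fml.code_injective hc he)
  rw [nameWorld, dif_pos hex]
  exact ⟨h1, h2⟩

/-- The facts true in a model respect the rules as soon as the name of a box is read as a witness of
its failure, which is what `nameWorld` provides. -/
theorem respects_holds {S : SemiThue L} {W : Type w} {M : Model L W} (hM : M.Satisfies S)
    {c : L → ℕ} (hc : Function.Injective c) {l : List ℕ} {w₀ : W}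
    (hl : ∀ F : Fml L, F.code c = l → ¬ M.Sat w₀ F) :
    Respects (factRules S c) {p | Holds M c l (nameWorld M c w₀) p} := by
  intro P Q hR hP
  have hR : FactRule S c P Q := hR
  have hcode := Fml.code_injective (L := L) hc
  have hsing : ∀ q : Fact, Holds M c l (nameWorld M c w₀) q →
      ∃ q' ∈ [q], q' ∈ {p | Holds M c l (nameWorld M c w₀) p} := fun q hq => ⟨q, by simp, hq⟩
  cases hR with
  | wf_atom p => exact hsing _ ⟨.atom p, rfl⟩
  | wf_natom p => exact hsing _ ⟨.natom p, rfl⟩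
  | wf_or A B =>
    obtain ⟨F, rfl⟩ := hP (wf A) (by simp)
    obtain ⟨G, rfl⟩ := hP (wf B) (by simp)
    exact hsing _ ⟨.or F G, rfl⟩
  | wf_and A B =>
    obtain ⟨F, rfl⟩ := hP (wf A) (by simp)
    obtain ⟨G, rfl⟩ := hP (wf B) (by simp)
    exact hsing _ ⟨.and F G, rfl⟩
  | wf_box a A =>
    obtain ⟨F, rfl⟩ := hP (wf A) (by simp)
    exact hsing _ ⟨.box a F, rfl⟩
  | wf_dia a A =>
    obtain ⟨F, rfl⟩ := hP (wf A) (by simp)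
    exact hsing _ ⟨.dia a F, rfl⟩
  | input A =>
    obtain rfl : A = l := hP (Fact.input A) (by simp)
    obtain ⟨F, hF⟩ := hP (wf A) (by simp)
    exact hsing _ ⟨F, hF, by rw [nameWorld]; exact hl F hF⟩
  | clash x p =>
    obtain ⟨F, hF, h1⟩ := hP (lab x [0, p]) (by simp)
    obtain ⟨G, hG, h2⟩ := hP (lab x [1, p]) (by simp)
    obtain rfl := hcode (a₂ := .atom p) hF
    obtain rfl := hcode (a₂ := .natom p) hG
    exact absurd h1 h2
  | or_left x A B =>
    obtain ⟨D, hD, h⟩ := hP (lab x (2 :: (A ++ B))) (by simp)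
    obtain ⟨F, rfl⟩ := hP (wf A) (by simp)
    obtain ⟨G, rfl⟩ := hP (wf B) (by simp)
    -- A list may split as `A ++ B` in several ways; the `wf` premises make both parts codes, and
    -- unique readability then identifies the disjuncts.
    obtain rfl := hcode (a₂ := .or F G) hD
    exact hsing _ ⟨F, rfl, fun h' => h (Or.inl h')⟩
  | or_right x A B =>
    obtain ⟨D, hD, h⟩ := hP (lab x (2 :: (A ++ B))) (by simp)
    obtain ⟨F, rfl⟩ := hP (wf A) (by simp)
    obtain ⟨G, rfl⟩ := hP (wf B) (by simp)
    obtain rfl := hcode (a₂ := .or F G) hD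
    exact hsing _ ⟨G, rfl, fun h' => h (Or.inr h')⟩
  | and x A B =>
    obtain ⟨D, hD, h⟩ := hP (lab x (3 :: (A ++ B))) (by simp)
    obtain ⟨F, rfl⟩ := hP (wf A) (by simp)
    obtain ⟨G, rfl⟩ := hP (wf B) (by simp)
    obtain rfl := hcode (a₂ := .and F G) hD
    rcases not_and_or.1 h with h | h
    · exact ⟨_, List.mem_cons_self, F, rfl, h⟩
    · exact ⟨_, List.mem_cons_of_mem _ List.mem_cons_self, G, rfl, h⟩
  | box_lab a x A =>
    obtain ⟨D, hD, h⟩ := hP (lab x (4 :: c a :: A)) (by simp)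
    cases D <;> simp [Fml.code] at hD
    obtain ⟨h1, rfl⟩ := hD
    obtain rfl := hc h1
    exact hsing _ ⟨_, rfl, (nameWorld_spec hc h).2⟩
  | box_rel a x A =>
    obtain ⟨D, hD, h⟩ := hP (lab x (4 :: c a :: A)) (by simp)
    cases D <;> simp [Fml.code] at hD
    obtain ⟨h1, rfl⟩ := hD
    obtain rfl := hc h1
    exact hsing _ ⟨[_], rfl, _, (nameWorld_spec hc h).1, rfl⟩
  | dia a x y A =>
    obtain ⟨D, hD, h⟩ := hP (lab x (5 :: c a :: A)) (by simp)
    cases D <;> simp [Fml.code] at hD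
    obtain ⟨h1, rfl⟩ := hD
    obtain rfl := hc h1
    obtain ⟨v, hv, h'⟩ := hP (rel [c _] x y) (List.mem_cons_of_mem _ List.mem_cons_self)
    obtain rfl := hc.list_map (a₂ := [_]) hv
    obtain ⟨z, hz, hzy⟩ := h'
    rw [show z = nameWorld M c w₀ y from hzy] at hz
    exact hsing _ ⟨_, rfl, fun hA => h ⟨_, hz, hA⟩⟩
  | rel_nil x => exact hsing _ ⟨[], rfl, rfl⟩
  | rel_cons m v x y z =>
    obtain ⟨v₁, h1, h1'⟩ := hP (rel [m] x y) (by simp)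
    obtain ⟨v₂, rfl, h2'⟩ := hP (rel v y z) (by simp)
    refine hsing _ ⟨v₁ ++ v₂, by simp [h1], ?_⟩
    exact (wordRel_append ..).2 ⟨_, h1', h2'⟩
  | rel_conv a x y =>
    obtain ⟨v, hv, h⟩ := hP (rel [c a] x y) (by simp)
    obtain rfl := hc.list_map (a₂ := [a]) hv
    obtain ⟨z, hz, hzy⟩ := h
    rw [show z = nameWorld M c w₀ y from hzy] at hz
    exact hsing _ ⟨[conv a], rfl, _, (M.rel_conv a _ _).1 hz, rfl⟩
  | rel_rule r x y =>
    obtain ⟨v, hv, h⟩ := hP (rel (r.1.2.map c) x y) (by simp)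
    obtain rfl := hc.list_map hv
    exact hsing _ ⟨_, rfl, hM _ _ r.2 _ _ h⟩

/-- Every rule set is satisfied by the model with a single reflexive world. -/
def unitModel (L : Type u) [ConverseAlphabet L] : Model L PUnit.{w + 1} where
  rel _ _ _ := True
  rel_conv _ _ _ := Iff.rfl
  val _ := ∅

theorem unitModel_satisfies (S : SemiThue L) : (unitModel.{u, w} L).Satisfies S := by
  have key : ∀ (v : List L) (x y : PUnit.{w + 1}), (unitModel L).wordRel v x y := by
    intro v
    induction v with
    | nil => exact fun _ _ => rfl
    | cons a v ih => exact fun x y => ⟨x, trivial, ih x y⟩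
  exact fun l r _ x y _ => key l x y

/-- A countermodel would give a respecting set of facts that contains the input. If `l` is no code
at all, nothing is asserted about any formula, and the facts of the one-world model already respect
the rules. -/
theorem exists_sValid_of_closedBy {S : SemiThue L} {c : L → ℕ} (hc : Function.Injective c)
    {l : List ℕ} (h : ClosedBy (factRules S c) [input l]) :
    ∃ F : Fml L, F.code c = l ∧ SValid.{u, w} S F := by
  have hinput : ∀ {W : Type w} (M : Model L W) (w₀ : W), ∀ p ∈ [input l],
      p ∈ {p | Holds M c l (nameWorld M c w₀) p} := fun M w₀ p hp => by
    rw [List.mem_singleton.1 hp]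
    exact (rfl : l = l)
  by_cases hex : ∃ F : Fml L, F.code c = l
  · obtain ⟨F, rfl⟩ := hex
    refine ⟨F, rfl, fun W M hM x => ?_⟩
    by_contra hx
    refine (respects_holds hM hc (w₀ := x) fun G hG => ?_).not_closedBy (hinput M x) h
    rwa [Fml.code_injective hc hG]
  · exact absurd h ((respects_holds (unitModel_satisfies.{u, w} S) hc (w₀ := PUnit.unit)
      fun F hF => absurd ⟨F, hF⟩ hex).not_closedBy (hinput _ _))

/-- A respecting set `T` containing the input is turned into a term model: worlds are the names, and
relations and valuation are read off `T`. The names form a type in universe `0`, hence the universe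
of `SValid`. -/
theorem closedBy_of_sValid {S : SemiThue L} {c : L → ℕ} (hcf : S.ContextFree) {F : Fml L}
    (hF : SValid.{u, 0} S F) : ClosedBy (factRules S c) [input (F.code c)] := by
  by_contra hcl
  obtain ⟨T, hT, hin⟩ := exists_respects_of_not_closedBy hcl
  have apply₁ : ∀ {P : List Fact} {q : Fact}, FactRule S c P [q] → (∀ p ∈ P, p ∈ T) → q ∈ T :=
    fun {P q} hR hP => by simpa using hT P [q] hR hP
  have hwf : ∀ A : Fml L, wf (A.code c) ∈ T := by
    intro A
    induction A with
    | atom p => exact apply₁ (.wf_atom p) (by simp)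
    | natom p => exact apply₁ (.wf_natom p) (by simp)
    | or A B ihA ihB => exact apply₁ (.wf_or _ _) (by simp [ihA, ihB])
    | and A B ihA ihB => exact apply₁ (.wf_and _ _) (by simp [ihA, ihB])
    | box a A ih => exact apply₁ (.wf_box a _) (by simp [ih])
    | dia a A ih => exact apply₁ (.wf_dia a _) (by simp [ih])
  let M : Model L (List (List ℕ)) :=
    { rel := fun a x y => rel [c a] x y ∈ T
      rel_conv := fun a x y => by
        refine ⟨fun h => apply₁ (.rel_conv a x y) (by simpa using h), fun h => ?_⟩
        have := apply₁ (.rel_conv (S := S) (conv a) y x) (by simpa using h)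
        rwa [ConverseAlphabet.conv_conv] at this
      val := fun p => {x | lab x [0, p] ∉ T} }
  have hword : ∀ (v : List L) (x y : List (List ℕ)), M.wordRel v x y → rel (v.map c) x y ∈ T := by
    intro v
    induction v with
    | nil =>
      rintro x y rfl
      exact apply₁ (.rel_nil x) (by simp)
    | cons a v ih =>
      rintro x y ⟨z, hz, h⟩
      have hz : rel [c a] x z ∈ T := hz
      exact apply₁ (.rel_cons (c a) (v.map c) x z y) (by simp [hz, ih z y h])
  have hM : M.Satisfies S := by
    intro l r hS x y h
    have h1 := apply₁ (.rel_rule (c := c) ⟨(l, r), hS⟩ x y) (by simpa using hword r x y h)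
    -- A fact `rel` for a longer word need not come from a path in `M`; for a single letter it is
    -- the relation of `M` itself.
    obtain ⟨a, rfl⟩ := hcf l r hS
    exact ⟨y, h1, rfl⟩
  have htruth : ∀ (A : Fml L) (x : List (List ℕ)), lab x (A.code c) ∈ T → ¬ M.Sat x A := by
    intro A
    induction A with
    | atom p => exact fun x h h' => h' h
    | natom p =>
      refine fun x h h' => h' fun h'' => ?_
      obtain ⟨q, hq, -⟩ := hT _ _ (.clash x p : FactRule S c _ _)
        (by simpa using ⟨h'', h⟩)
      simp at hq
    | or A B ihA ihB =>
      intro x h h'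
      have hP : ∀ p ∈ [lab x (2 :: (A.code c ++ B.code c)), wf (A.code c), wf (B.code c)],
          p ∈ T := by simpa using ⟨h, hwf A, hwf B⟩
      exact h'.elim (ihA x (apply₁ (.or_left x _ _) hP)) (ihB x (apply₁ (.or_right x _ _) hP))
    | and A B ihA ihB =>
      intro x h h'
      obtain ⟨q, hq, hqT⟩ := hT _ _ (.and x (A.code c) (B.code c) : FactRule S c _ _)
        (by simpa using ⟨h, hwf A, hwf B⟩)
      simp only [List.mem_cons, List.not_mem_nil, or_false] at hq
      rcases hq with rfl | rfl
      · exact ihA x hqT h'.1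
      · exact ihB x hqT h'.2
    | box a A ih =>
      intro x h h'
      have hP : ∀ p ∈ [lab x (4 :: c a :: A.code c)], p ∈ T := by
        rintro _ hp
        rwa [List.mem_singleton.1 hp]
      exact ih _ (apply₁ (.box_lab a x _) hP) (h' _ (apply₁ (.box_rel a x _) hP))
    | dia a A ih =>
      rintro x h ⟨y, hy, h'⟩
      exact ih y (apply₁ (.dia a x y _) (by simpa using ⟨h, hy⟩)) h'
  exact htruth F [] (apply₁ (.input _) (by simpa using ⟨hin _ (by simp), hwf F⟩))
    (hF _ M hM [])

/-- Validity of formulae is recursively enumerable, for finite systems over finite alphabets. -/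
theorem rePred_sValid [Finite L] {S : SemiThue L} (hcf : S.ContextFree) (hS : S.Finite)
    {c : L → ℕ} (hc : Function.Injective c) :
    REPred fun l : List ℕ => ∃ F : Fml L, F.code c = l ∧ SValid.{u, 0} S F := by
  have hg : Primrec fun l : List ℕ => [input l] :=
    primrec_cons (primrec_input primrec_self) (Primrec.const [])
  refine ((ruleEnum_factRules hS c).rePred_closedBy hg).of_eq fun l =>
    ⟨exists_sValid_of_closedBy hc, ?_⟩
  rintro ⟨F, rfl, hF⟩
  exact closedBy_of_sValid hcf hF

end RuleSemantics

end GrammarLogic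

/-! ### Assembly of the theorem -/

open GrammarLogic in
theorem mainTheorem8 {L : Type u} [ConverseAlphabet L] (S : SemiThue L)
    (hcf : S.ContextFree) (hcl : S.Closed) :
    -- soundness and completeness: for some run and for every run of the procedure
    (∀ F : Fml L,
      (ProveReturns S (NSeq.ofFmls {F}) .top ↔ NSeq.DKm S (NSeq.ofFmls {F})) ∧
      (ProveAlwaysReturns S (NSeq.ofFmls {F}) .top ↔ NSeq.DKm S (NSeq.ofFmls {F}))) ∧
    -- `Prove` semi-decides the grammar logic of `S`: it accepts exactly the `S`-valid formulae,
    (∀ F : Fml L, ProveReturns S (NSeq.ofFmls {F}) .top ↔ SValid.{u, w} S F) ∧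
    -- each bounded search terminates,
    (∀ (F : Fml L) (k : ℕ), Prove₂Terminates S k (NSeq.ofFmls {F})) ∧
    -- and, for a finite system over a finite alphabet, acceptance is semi-decidable
    (Finite L → S.Finite → ∀ c : L → ℕ, Function.Injective c →
      REPred fun l : List ℕ =>
        ∃ F : Fml L, F.code c = l ∧ ProveReturns S (NSeq.ofFmls {F}) .top) ∧
    -- every `S`-stable nested sequent has a countermodel
    (∀ Γ : NSeq L, Γ.Stable S →
      ∃ (W : Type w) (M : Model L W), Nonempty W ∧ M.Satisfies S ∧
        ∀ x, Γ.IsNode x → ∃ v : W, ∀ A ∈ Γ.at' x, ¬ M.Sat v A) := by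
  have always : ∀ F : Fml L, NSeq.DKm S (NSeq.ofFmls {F}) →
      ProveAlwaysReturns S (NSeq.ofFmls {F}) .top := fun F h =>
    proveAlwaysReturns_of_sValid hcf hcl (sValid_of_dkm.{u, 0} h)
  refine ⟨fun F => ⟨⟨ProveReturns.dkm, fun h => (always F h).proveReturns⟩,
    fun h => h.proveReturns.dkm, always F⟩, fun F => ⟨fun h => sValid_of_dkm h.dkm, fun h =>
    (proveAlwaysReturns_of_sValid hcf hcl h).proveReturns⟩, prove₂Terminates S,
    fun hL hS c hc => ?_, fun Γ hΓ => NSeq.Stable.exists_countermodel hcf hcl hΓ⟩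
  -- Acceptance agrees with validity in every universe, so the enumeration of validity over worlds
  -- in universe `0` suffices.
  refine (rePred_sValid hcf hS hc).of_eq fun l => exists_congr fun F => and_congr_right fun _ =>
    ⟨fun h => (proveAlwaysReturns_of_sValid hcf hcl h).proveReturns,
      fun h => sValid_of_dkm h.dkm⟩
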